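/- **Setting.** Identify the plane with $\mathbb C$ and write $x\angle\theta=xe^{i\theta}$. The considered secondary link has its receiver at the origin and its transmitter at $X_{s0}=r_s\angle 0$, with orientation $\pi$. The primary transmitter is at $X_{p0}=x_{p0}\angle\delta_{p0}$ and the primary receiver at $Y_{p0}=X_{p0}+r_p\angle\omega_{p0}\neq X_{s0}$, where $r_s,r_p,x_{p0}>0$. The secondary transmitters form a homogeneous Poisson point process of density $\lambda_s>0$ in the plane; we condition (in the sense of Palm probabilities) on there being one at $X_{s0}$, and let $X_i=x_i\angle\theta_i$ be the others. Their orientations $\omega_i$ are uniform on $(0,2\pi]$. The powers are $p_p,p_s>0$, the noise power is $\sigma^2>0$, the restriction threshold is $\rho>0$, and the SINR threshold is $\tau>0$. The beam patterns $g_{pt},g_{pr},g_{st},g_{sr}\ge 0$ (primary/secondary, transmitter/receiver) are measurable and $2\pi$-periodic. A path of length $z$ is in state $T\in\{\mathrm L,\mathrm N\}$ with probability $p_{\mathrm L}(z)=e^{-(\mu z+p)}$, $p_{\mathrm N}(z)=1-p_{\mathrm L}(z)$ ($\mu,p\ge0$), and then has path loss $\ell_T(z)=C_Tz^{-\alpha_T}$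 ($C_T\ge0$, $\alpha_T>0$). All fading coefficients (written $F,G$ below) are exponential with mean $1$. Given the locations, all orientations, blockage states and fading coefficients are independent. Let $\beta(x)=\angle(x-Y_{p0})$ for all $x$ (the result holds likewise with $\beta(x)=\angle(Y_{p0}-x)$ for all $x$). A secondary transmitter at $x$ with orientation $\omega$, whose path to $Y_{p0}$ has state $T$ and fading $G$, is active if and only if $$p_s\,G\,g_{pr}(\omega_{p0}-\beta(x))\,g_{st}(\beta(x)-\omega)\,\ell_T(|x-Y_{p0}|)<\rho ;$$ let $U_0,U_i\in\{0,1\}$ be the activity indicators of the transmitters at $X_{s0}$ and $X_i$. The SINR of the considered link is $$\mathsf{SINR}_{s0}=\frac{F_{0}\,U_0\,p_s\,g_{st}(0)g_{sr}(0)\,\ell_{T_{s0}}(r_s)}{\sigma^2+I_p+I_s},$$ $$I_p=p_p\,g_{sr}(\delta_{p0})\,g_{pt}(\delta_{p0}-\pi-\omega_{p0})\,G'\,\ell_{T_{p0\to s0}}(x_{p0}),\qquad I_s=\sum_i p_s\,g_{sr}(\theta_i)\,g_{st}(\theta_i-\pi-\omega_i)\,U_i\,F'_i\,\ell_{T_{si\to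 s0}}(x_i).$$ **Theorem.** The coverage probability $p_{cs}(\tau,\mu,\rho)=\mathbb P[\mathsf{SINR}_{s0}>\tau]$ is $$p_{cs}=\sum_{T}p_T(r_s)\,e^{-\tau\sigma^2/A_0^T}\Big[1-\sum_{T_1}p_{T_1}(z_{00})e^{-1/A_{10}^{T_1}}\Big]\Big(\sum_{T_2}\frac{p_{T_2}(x_{p0})}{1+\tau A_{20}^{T_2}/A_0^T}\Big)\exp\Big(-\lambda_s\,J_T\Big),$$ $$J_T=\int_0^{2\pi}\!\!\int_0^\infty\sum_{T_3}p_{T_3}(x)\,\mathbb E_{\omega}\Big[\frac{1-\sum_{T_4}p_{T_4}(z_0)\,e^{-A_{s0}^{T_4}z_0^{\alpha_{T_4}}}}{1+C_s^{T_3}x^{\alpha_{T_3}}}\Big]x\,dx\,d\theta ,$$ where all sums are over $\{\mathrm L,\mathrm N\}$, $\omega$ is uniform on $(0,2\pi]$, $z_{00}=|X_{s0}-Y_{p0}|$, $\beta_{00}=\beta(X_{s0})$, $z_0=|x\angle\theta-Y_{p0}|$, $\beta_0=\beta(x\angle\theta)$, and $$A_0^T=p_sg_{st}(0)g_{sr}(0)C_Tr_s^{-\alpha_T},\quad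 A_{10}^{T_1}=\frac{p_s\,g_{st}(\beta_{00}-\pi)\,g_{pr}(\omega_{p0}-\beta_{00})\,C_{T_1}z_{00}^{-\alpha_{T_1}}}{\rho},$$ $$A_{20}^{T_2}=p_p\,g_{pt}(\delta_{p0}-\pi-\omega_{p0})\,g_{sr}(\delta_{p0})\,C_{T_2}\,x_{p0}^{-\alpha_{T_2}},\quad A_{s0}^{T_4}=\frac{\rho}{p_s\,C_{T_4}\,g_{st}(\beta_0-\omega)\,g_{pr}(\omega_{p0}-\beta_0)},$$ $$C_s^{T_3}=\frac{A_0^T}{\tau\,p_s\,C_{T_3}\,g_{st}(\theta-\omega-\pi)\,g_{sr}(\theta)} .$$ Expressions are evaluated in $[0,\infty]$, with $a/0=\infty$ for $a>0$, $0/0=0$, $a/\infty=0$ for $a<\infty$, $0\cdot\infty=0$ and $e^{-\infty}=0$. -/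

import Mathlib

open MeasureTheory ProbabilityTheory
open scoped ENNReal NNReal

noncomputable section

namespace SLS

/-! ### Elementary notions -/

/-- The point `x∠θ` of the plane, the plane being identified with `ℂ`. -/
def polar (x θ : ℝ) : ℂ := (x : ℂ) * Complex.exp ((θ : ℂ) * Complex.I)

/-- `a ↦ e^{-a}` on `[0, ∞]`, with `e^{-∞} = 0`. -/
def expNeg (a : ℝ≥0∞) : ℝ≥0∞ := if a = ∞ then 0 else ENNReal.ofReal (Real.exp (-a.toReal))

/-- The uniform distribution on `(0, 2π]`. -/
def uniformAngle : Measure ℝ :=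
  (ENNReal.ofReal (2 * Real.pi))⁻¹ • volume.restrict (Set.Ioc 0 (2 * Real.pi))

/-! ### Point processes in the plane -/

/-- The counting measure `∑ᵢ δ_{xᵢ}` of a family of points. -/
def config {ι : Type*} (x : ι → ℂ) : Measure ℂ := Measure.sum fun i => Measure.dirac (x i)

/-- The random points `Z₀, Z₁, …` form a homogeneous Poisson point process of density `lam`:
the number of points in a Borel set of finite area is Poisson with mean `lam * area`, and the
numbers of points in disjoint Borel sets are independent.  (For `lam > 0` there are almost surely
infinitely many points, so that they can be indexed by `ℕ`.) -/
structure IsPoissonProcess {Ω : Type*} [MeasurableSpace Ω] (lam : ℝ≥0) (Z : ℕ → Ω → ℂ)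
    (P : Measure Ω) : Prop where
  measurable : ∀ i, Measurable (Z i)
  law_count : ∀ B : Set ℂ, MeasurableSet B → volume B ≠ ∞ →
    P.map (fun ω => config (fun i => Z i ω) B) =
      (poissonMeasure (lam * (volume B).toNNReal)).map (fun n : ℕ => (n : ℝ≥0∞))
  indep_count : ∀ (n : ℕ) (B : Fin n → Set ℂ), (∀ k, MeasurableSet (B k)) →
    Pairwise (fun k l => Disjoint (B k) (B l)) →
    iIndepFun (fun k ω => config (fun i => Z i ω) (B k)) P

/-- `Q` is the reduced Palm distribution at the location `a` of the stationary point process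
`Z₀, Z₁, …` of density `lam`, i.e. the law of the remaining points given that the process has a
point at `a`: for every Borel set `B` of finite area and every measurable set `A` of
configurations, `lam * area(B) * Q(A)` is the mean number of points `Zᵢ ∈ B` for which the other
points, translated so that `Zᵢ` moves to `a`, form a configuration in `A`. -/
def IsReducedPalm {Ω : Type*} [MeasurableSpace Ω] (lam : ℝ≥0) (a : ℂ) (Z : ℕ → Ω → ℂ)
    (P : Measure Ω) (Q : Measure (Measure ℂ)) : Prop :=
  ∀ B : Set ℂ, MeasurableSet B → volume B ≠ ∞ → ∀ A : Set (Measure ℂ), MeasurableSet A →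
    lam * volume B * Q A =
      ∫⁻ ω, ∑' i : ℕ, B.indicator 1 (Z i ω) *
        A.indicator 1 (config fun j : {j : ℕ // j ≠ i} => Z j ω - Z i ω + a) ∂P

/-- Conditionally on the points `X₀, X₁, …`, the marks `M₀, M₁, …` are independent, and the mark
`Mᵢ` has the distribution `ν (Xᵢ)`. -/
def IsIndepMarking {Ω K : Type*} [MeasurableSpace Ω] [MeasurableSpace K] (X : ℕ → Ω → ℂ)
    (M : ℕ → Ω → K) (ν : ℂ → Measure K) (P : Measure Ω) : Prop :=
  ∀ (I : Finset ℕ) (A : Set (ℕ → ℂ)), MeasurableSet A →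
    ∀ B : ℕ → Set K, (∀ i, MeasurableSet (B i)) →
      P ({ω | (fun i => X i ω) ∈ A} ∩ {ω | ∀ i ∈ I, M i ω ∈ B i}) =
        ∫⁻ ω in {ω | (fun i => X i ω) ∈ A}, ∏ i ∈ I, ν (X i ω) (B i) ∂P

/-! ### Parameters of the network

A blockage state is a Boolean: `true` is line of sight (L), `false` is non line of sight (N).
Coordinates are those of the considered secondary link, with its receiver at `0` and its
transmitter at `r_s∠0`. -/

/-- The two possible orientations of the line through a secondary transmitter `x` and the primary
receiver `Y` in which its angle can be measured. -/
inductive Bearing where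
  | fromPrimary : Bearing
  | toPrimary : Bearing

/-- The angle `β` of the line through the secondary transmitter `x` and the primary receiver `Y`:
`∠(x - Y)` or `∠(Y - x)`. -/
def Bearing.angle (b : Bearing) (Y x : ℂ) : ℝ :=
  match b with
  | .fromPrimary => Complex.arg (x - Y)
  | .toPrimary => Complex.arg (Y - x)

/-- Parameters: density `lam` of the secondary transmitters, transmit powers `pp`, `ps`,
restriction threshold `rho`, noise power `sig2`, blockage parameters `mu`, `pB`, link lengths `rp`,
`rs`, polar coordinates `xp∠deltap` of the primary transmitter, direction `omegap` of the primary
link (from transmitter to receiver), path-loss constants `C` and exponents `alpha`, and the beam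
patterns of the primary/secondary transmitters/receivers. -/
structure Params where
  lam : ℝ≥0
  pp : ℝ≥0
  ps : ℝ≥0
  rho : ℝ≥0
  sig2 : ℝ≥0
  mu : ℝ≥0
  pB : ℝ≥0
  rp : ℝ
  rs : ℝ
  xp : ℝ
  deltap : ℝ
  omegap : ℝ
  C : Bool → ℝ≥0
  alpha : Bool → ℝ
  gpt : ℝ → ℝ≥0
  gpr : ℝ → ℝ≥0
  gst : ℝ → ℝ≥0
  gsr : ℝ → ℝ≥0

/-- A beam pattern, as a function of the angle to the beam orientation. -/
structure IsBeamPattern (g : ℝ → ℝ≥0) : Prop where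
  measurable : Measurable g
  periodic : Function.Periodic g (2 * Real.pi)

namespace Params

variable (S : Params)

/-- Location of the primary transmitter. -/
def Xp : ℂ := polar S.xp S.deltap

/-- Location of the primary receiver. -/
def Yp : ℂ := S.Xp + polar S.rp S.omegap

/-- Location of the considered secondary transmitter. -/
def Xs : ℂ := polar S.rs 0

/-- Standing assumptions; the last one says that the considered secondary transmitter and the
primary receiver are at different places. -/
structure Admissible : Prop where
  lam_pos : 0 < S.lam
  pp_pos : 0 < S.pp
  ps_pos : 0 < S.ps
  rho_pos : 0 < S.rho
  sig2_pos : 0 < S.sig2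
  rp_pos : 0 < S.rp
  rs_pos : 0 < S.rs
  xp_pos : 0 < S.xp
  alpha_pos : ∀ T, 0 < S.alpha T
  gpt_beam : IsBeamPattern S.gpt
  gpr_beam : IsBeamPattern S.gpr
  gst_beam : IsBeamPattern S.gst
  gsr_beam : IsBeamPattern S.gsr
  Xs_ne_Yp : S.Xs ≠ S.Yp

/-- `p_T(z)`: probability of the blockage state `T` on a path of length `z ≥ 0`. -/
def pr (T : Bool) (z : ℝ) : ℝ≥0∞ :=
  if T then ENNReal.ofReal (Real.exp (-(S.mu * z + S.pB)))
  else 1 - ENNReal.ofReal (Real.exp (-(S.mu * z + S.pB)))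

/-- Distribution of the blockage state of a path of length `z`. -/
def stateLaw (z : ℝ) : Measure Bool :=
  S.pr true z • Measure.dirac true + S.pr false z • Measure.dirac false

/-- Path loss `ℓ_T(z) = C_T z^{-α_T}`. -/
def pathLoss (T : Bool) (z : ℝ) : ℝ≥0∞ := S.C T * ENNReal.ofReal z ^ (-S.alpha T)

/-- Received power at the primary receiver due to a secondary transmitter at `x` with orientation
`w`, fading `G` and blockage state `T`. -/
def powerAtPrimary (b : Bearing) (x : ℂ) (w G : ℝ) (T : Bool) : ℝ≥0∞ :=
  S.ps * ENNReal.ofReal G * S.gpr (S.omegap - b.angle S.Yp x) * S.gst (b.angle S.Yp x - w) *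
    S.pathLoss T ‖x - S.Yp‖

/-- Activity indicator of such a transmitter: it may transmit only if it causes less than `rho` at
the primary receiver. -/
def active (b : Bearing) (x : ℂ) (w G : ℝ) (T : Bool) : ℝ≥0∞ :=
  if S.powerAtPrimary b x w G T < S.rho then 1 else 0

/-- Distribution of the marks `(ω, T_{s→p0}, T_{s→s0}, G, F)` of an interfering secondary
transmitter at `x`: its orientation, the blockage states of its paths to the primary receiver and
to the considered secondary receiver, and the Rayleigh fading (power) coefficients of these. -/
def markLaw (x : ℂ) : Measure (ℝ × Bool × Bool × ℝ × ℝ) :=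
  uniformAngle.prod ((S.stateLaw ‖x - S.Yp‖).prod ((S.stateLaw ‖x‖).prod
    ((expMeasure 1).prod (expMeasure 1))))

end Params

/-! ### The random network around the considered secondary link -/

/-- The random variables of the network seen from the considered link: for the other secondary
transmitters the locations `X`, orientations `om`, blockage states `TP`, `TS` of the paths to the
primary and to the considered secondary receiver, and fading coefficients `G`, `F` on these; for
the considered link, the blockage states `T00` (own link), `TsP` (its transmitter to the primary
receiver), `TpS` (primary transmitter to its receiver) with fading coefficients `F00`, `G00`,
`GpS`. -/
structure Network (Ω : Type*) where
  X : ℕ → Ω → ℂ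
  om : ℕ → Ω → ℝ
  TP : ℕ → Ω → Bool
  TS : ℕ → Ω → Bool
  G : ℕ → Ω → ℝ
  F : ℕ → Ω → ℝ
  T00 : Ω → Bool
  TsP : Ω → Bool
  TpS : Ω → Bool
  F00 : Ω → ℝ
  G00 : Ω → ℝ
  GpS : Ω → ℝ

namespace Network

variable {Ω : Type*} (N : Network Ω) (S : Params)

/-- The marks of the `i`-th other transmitter. -/
def mark (i : ℕ) (ω : Ω) : ℝ × Bool × Bool × ℝ × ℝ :=
  (N.om i ω, N.TP i ω, N.TS i ω, N.G i ω, N.F i ω)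

/-- The variables that belong to the considered link and the primary transmitter. -/
def own (ω : Ω) : Bool × Bool × Bool × ℝ × ℝ × ℝ :=
  (N.T00 ω, N.TsP ω, N.TpS ω, N.F00 ω, N.G00 ω, N.GpS ω)

/-- Joint law of the variables, apart from the law of the locations of the other transmitters:
all paths are blocked independently with the length-dependent probabilities, all fading
coefficients are exponential with mean one, orientations are uniform, and everything is
independent. -/
structure HasModelLaw [MeasurableSpace Ω] (P : Measure Ω) : Prop where
  measurable_X : ∀ i, Measurable (N.X i)
  measurable_mark : ∀ i, Measurable (N.mark i)
  measurable_own : Measurable N.own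
  marking : IsIndepMarking N.X N.mark S.markLaw P
  law_own : P.map N.own =
    (S.stateLaw S.rs).prod ((S.stateLaw ‖S.Xs - S.Yp‖).prod ((S.stateLaw S.xp).prod
      ((expMeasure 1).prod ((expMeasure 1).prod (expMeasure 1)))))
  indep_own : IndepFun N.own (fun ω i => (N.X i ω, N.mark i ω)) P

/-- Interference of the primary transmitter at the considered secondary receiver. -/
def primaryInterference (ω : Ω) : ℝ≥0∞ :=
  S.pp * (S.gsr S.deltap * S.gpt (S.deltap - Real.pi - S.omegap)) * ENNReal.ofReal (N.GpS ω) *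
    S.pathLoss (N.TpS ω) S.xp

/-- Interference of the other active secondary transmitters at the considered receiver. -/
def secondaryInterference (b : Bearing) (ω : Ω) : ℝ≥0∞ :=
  ∑' i : ℕ, S.ps *
    (S.gsr (Complex.arg (N.X i ω)) * S.gst (Complex.arg (N.X i ω) - Real.pi - N.om i ω)) *
    S.active b (N.X i ω) (N.om i ω) (N.G i ω) (N.TP i ω) * ENNReal.ofReal (N.F i ω) *
    S.pathLoss (N.TS i ω) ‖N.X i ω‖

/-- SINR at the considered secondary receiver; its transmitter has orientation `π`. -/
def sinr (b : Bearing) (ω : Ω) : ℝ≥0∞ :=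
  ENNReal.ofReal (N.F00 ω) * S.active b S.Xs Real.pi (N.G00 ω) (N.TsP ω) * S.ps *
      S.gst 0 * S.gsr 0 * S.pathLoss (N.T00 ω) S.rs /
    (S.sig2 + N.primaryInterference S ω + N.secondaryInterference S b ω)

end Network

/-! ### The quantities in the coverage formula -/

namespace Params

variable (S : Params)

/-- Distance `z₀₀` of the considered secondary transmitter from the primary receiver. -/
def z00 : ℝ := ‖S.Xs - S.Yp‖

/-- Angle `β₀₀`. -/
def beta00 (b : Bearing) : ℝ := b.angle S.Yp S.Xs

/-- Distance `z₀` of `x∠θ` from the primary receiver. -/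
def z0 (x θ : ℝ) : ℝ := ‖polar x θ - S.Yp‖

/-- Angle `β₀(x, θ)`. -/
def beta0 (b : Bearing) (x θ : ℝ) : ℝ := b.angle S.Yp (polar x θ)

/-- `A₀^T`: serving power. -/
def A0 (T : Bool) : ℝ≥0∞ :=
  S.ps * S.gst 0 * S.gsr 0 * S.C T * ENNReal.ofReal S.rs ^ (-S.alpha T)

/-- `A₁₀^T`: considered-secondary-to-primary interference relative to `rho`. -/
def A10 (b : Bearing) (T : Bool) : ℝ≥0∞ :=
  S.ps * S.gst (S.beta00 b - Real.pi) * S.gpr (S.omegap - S.beta00 b) * S.C T *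
    ENNReal.ofReal S.z00 ^ (-S.alpha T) / S.rho

/-- `A₂₀^T`: primary-to-considered-secondary interference. -/
def A20 (T : Bool) : ℝ≥0∞ :=
  S.pp * S.gpt (S.deltap - Real.pi - S.omegap) * S.gsr S.deltap * S.C T *
    ENNReal.ofReal S.xp ^ (-S.alpha T)

/-- `A_{s0}^T(w, β₀(x, θ))`. -/
def As0 (b : Bearing) (T : Bool) (w x θ : ℝ) : ℝ≥0∞ :=
  S.rho / (S.ps * S.C T * S.gst (S.beta0 b x θ - w) * S.gpr (S.omegap - S.beta0 b x θ))

/-- `C_s^{T₃}(w, θ)`, which also depends on the state `T` of the considered link. -/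
def Cs (τ : ℝ≥0) (T T₃ : Bool) (w θ : ℝ) : ℝ≥0∞ :=
  S.A0 T / (τ * S.ps * S.C T₃ * S.gst (θ - w - Real.pi) * S.gsr θ)

end Params

end SLS

end

open Filter Topology

noncomputable section

namespace SLS

/-! ### The function `a ↦ e^{-a}` on `[0, ∞]` -/

/-! Let V be the interference of the other secondary transmitters. It is independent of the
variables of the considered link. With U₀ the activity indicator, coverage means τ(σ² + A₂₀G' + V) <
F·A₀·U₀. The exponential tail of F turns this into the product
e^{-τσ²/A₀}·e^{-τA₂₀G'/A₀}·e^{-τV/A₀}; the mean over G' is the Laplace transform of an exponential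
law, and the mean of U₀ is another exponential tail (`Params.Admissible.own_law_lt`). What remains
is E[e^{-τV/A₀}], where V is shot noise of a marked point process.

The point process here is known only through its Palm distribution, so the core is Slivnyak's
theorem: given a point, the others have the Laplace functional exp(-λ∫(1 - e^{-h}))
(`IsReducedPalm.laplace`). That functional is computed for Poisson processes from the counts
(`IsPoissonProcess.laplace`), and differentiating it in a direction u gives the Mecke formula
(`IsPoissonProcess.mecke_laplace`). The Palm identity translates a typical point to the prescribed
location; when the typical point lies in a small ball, the translation hardly affects a continuous
compactly supported h, and comparison with Mecke settles that case. An intensity bound and L¹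
density extend it to measurable h.

Independent marks replace e^{-g} by its conditional mean (`IsIndepMarking.laplace`). Integrating the
marks of one transmitter (`Params.Admissible.lintegral_interference`) and passing to polar
coordinates yields J_T. -/

lemma expNeg_eq_exp (a : ℝ≥0∞) : expNeg a = EReal.exp (-(a : EReal)) := by
  unfold expNeg
  split_ifs with h
  · simp [h]
  · lift a to ℝ≥0 using h
    have : -(((a : ℝ≥0∞)) : EReal) = ((-(a : ℝ) : ℝ) : EReal) := by
      rw [EReal.coe_neg]; rfl
    rw [this, EReal.exp_coe]; simp

@[simp] lemma expNeg_zero : expNeg 0 = 1 := by simp [expNeg]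

@[simp] lemma expNeg_top : expNeg ∞ = 0 := by simp [expNeg]

lemma expNeg_coe (a : ℝ≥0) : expNeg a = ENNReal.ofReal (Real.exp (-a)) := by simp [expNeg]

lemma expNeg_ofReal {a : ℝ} (ha : 0 ≤ a) :
    expNeg (ENNReal.ofReal a) = ENNReal.ofReal (Real.exp (-a)) := by
  simp [expNeg, ha]

lemma expNeg_add (a b : ℝ≥0∞) : expNeg (a + b) = expNeg a * expNeg b := by
  rcases eq_or_ne a ∞ with rfl | ha
  · simp
  rcases eq_or_ne b ∞ with rfl | hb
  · simp
  lift a to ℝ≥0 using ha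
  lift b to ℝ≥0 using hb
  rw [← ENNReal.coe_add, expNeg_coe, expNeg_coe, expNeg_coe,
    ← ENNReal.ofReal_mul (Real.exp_nonneg _), ← Real.exp_add]
  push_cast; ring_nf

lemma expNeg_sum {ι : Type*} (s : Finset ι) (f : ι → ℝ≥0∞) :
    expNeg (∑ i ∈ s, f i) = ∏ i ∈ s, expNeg (f i) := by
  classical
  induction s using Finset.induction_on with
  | empty => simp
  | insert i s hi ih => rw [Finset.sum_insert hi, Finset.prod_insert hi, expNeg_add, ih]

lemma expNeg_antitone : Antitone expNeg := by
  intro a b h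
  rw [expNeg_eq_exp, expNeg_eq_exp]
  exact EReal.exp_monotone (EReal.neg_le_neg_iff.2 (EReal.coe_ennreal_le_coe_ennreal_iff.2 h))

lemma expNeg_le_one (a : ℝ≥0∞) : expNeg a ≤ 1 := by
  simpa using expNeg_antitone (zero_le (a := a))

lemma expNeg_ne_top (a : ℝ≥0∞) : expNeg a ≠ ∞ :=
  ((expNeg_le_one a).trans_lt ENNReal.one_lt_top).ne

lemma expNeg_ne_zero {a : ℝ≥0∞} (ha : a ≠ ∞) : expNeg a ≠ 0 := by
  simp [expNeg, ha, Real.exp_pos]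

lemma continuous_expNeg : Continuous expNeg := by
  have : expNeg = fun a : ℝ≥0∞ => EReal.exp (-(a : EReal)) := funext expNeg_eq_exp
  rw [this]
  exact ENNReal.continuous_exp.comp (continuous_neg.comp continuous_coe_ennreal_ereal)

@[fun_prop]
lemma measurable_expNeg : Measurable expNeg := continuous_expNeg.measurable

/-- The inverse of `expNeg` on `[0, 1]`. -/
def negLog (y : ℝ≥0∞) : ℝ≥0∞ := (-(ENNReal.log y)).toENNReal

lemma expNeg_negLog {y : ℝ≥0∞} (hy : y ≤ 1) : expNeg (negLog y) = y := by
  have h : 0 ≤ -(ENNReal.log y) := by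
    rw [EReal.neg_nonneg]
    exact ENNReal.log_le_zero_iff.2 hy
  rw [negLog, expNeg_eq_exp, EReal.coe_toENNReal h, neg_neg, ENNReal.exp_log]

@[fun_prop]
lemma measurable_negLog : Measurable negLog :=
  (ENNReal.measurable_log.neg).ereal_toENNReal

lemma one_sub_expNeg_le (a : ℝ≥0∞) : 1 - expNeg a ≤ a := by
  rcases eq_or_ne a ∞ with rfl | ha
  · simp
  lift a to ℝ≥0 using ha
  rw [expNeg_coe, ← ENNReal.ofReal_one, ← ENNReal.ofReal_sub _ (Real.exp_nonneg _)]
  rw [← ENNReal.ofReal_coe_nnreal]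
  apply ENNReal.ofReal_le_ofReal
  linarith [Real.one_sub_le_exp_neg (a : ℝ)]

lemma one_sub_expNeg_add (a b : ℝ≥0∞) :
    1 - expNeg (a + b) = (1 - expNeg a) + expNeg a * (1 - expNeg b) := by
  rw [expNeg_add, ENNReal.mul_sub (fun _ _ => expNeg_ne_top a), mul_one]
  refine (tsub_add_tsub_cancel (expNeg_le_one a) ?_).symm
  exact mul_le_of_le_one_right' (expNeg_le_one b)

lemma one_sub_expNeg_add_le (a b : ℝ≥0∞) : 1 - expNeg (a + b) ≤ (1 - expNeg a) + b := by
  rw [one_sub_expNeg_add]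
  gcongr
  exact (mul_le_of_le_one_left' (expNeg_le_one a)).trans (one_sub_expNeg_le b)

/-- The Lipschitz bound for e^{-a}, written without subtraction; it makes Laplace functionals stable
under L¹ errors. -/
lemma expNeg_le_expNeg_add (a b : ℝ≥0∞) : expNeg a ≤ expNeg (a + b) + b := by
  have h : expNeg a * (expNeg b + b) = expNeg (a + b) + expNeg a * b := by
    rw [expNeg_add]; ring
  have h1 : 1 ≤ expNeg b + b := by
    have := one_sub_expNeg_le b
    rwa [tsub_le_iff_left] at this
  calc expNeg a = expNeg a * 1 := by simp
    _ ≤ expNeg a * (expNeg b + b) := by gcongr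
    _ = expNeg (a + b) + expNeg a * b := h
    _ ≤ expNeg (a + b) + b := by gcongr; exact mul_le_of_le_one_left' (expNeg_le_one a)

/-- The difference quotients `2ᵏ (1 - e^{-a/2ᵏ})`, which increase to `a`. -/
def expQuot (k : ℕ) (a : ℝ≥0∞) : ℝ≥0∞ := 2 ^ k * (1 - expNeg (a / 2 ^ k))

lemma expQuot_le (k : ℕ) (a : ℝ≥0∞) : expQuot k a ≤ a := by
  calc expQuot k a ≤ 2 ^ k * (a / 2 ^ k) := by unfold expQuot; gcongr; exact one_sub_expNeg_le _
    _ = a := ENNReal.mul_div_cancel (by simp) (by simp)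

lemma expQuot_mono (k : ℕ) : Monotone (expQuot k) := by
  intro a b h
  unfold expQuot
  gcongr
  exact expNeg_antitone (by gcongr)

/-- Halving the step: 1 - e^{-2y} = (1 - e^{-y})(1 + e^{-y}) ≤ 2(1 - e^{-y}). -/
lemma expQuot_monotone (a : ℝ≥0∞) : Monotone fun k => expQuot k a := by
  refine monotone_nat_of_le_succ fun k => ?_
  unfold expQuot
  set y := a / 2 ^ (k + 1)
  have hy : a / 2 ^ k = y + y := by
    rw [← two_mul, ← mul_div_assoc, pow_succ', ENNReal.mul_div_mul_left _ _ (by simp) (by simp)]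
  rw [hy, one_sub_expNeg_add, pow_succ, mul_assoc]
  gcongr
  rw [two_mul]
  gcongr
  exact mul_le_of_le_one_left' (expNeg_le_one y)

lemma tendsto_expQuot (a : ℝ≥0∞) : Tendsto (fun k => expQuot k a) atTop (𝓝 a) := by
  rcases eq_or_ne a ∞ with rfl | ha
  · have : (fun k => expQuot k ∞) = fun k => (2 : ℝ≥0∞) ^ k := by
      ext k; simp [expQuot, ENNReal.top_div]
    rw [this]
    exact ENNReal.tendsto_pow_atTop_nhds_top_iff.2 (by norm_num)
  lift a to ℝ≥0 using ha
  -- For finite a, `expQuot k a` is the slope of s ↦ 1 - e^{-as} between 0 and 2^{-k}.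
  have hd : HasDerivAt (fun s : ℝ => 1 - Real.exp (-(a * s))) a 0 := by
    have h1 : HasDerivAt (fun s : ℝ => -((a : ℝ) * s)) (-(a : ℝ)) 0 := by
      simpa using ((hasDerivAt_id (0 : ℝ)).const_mul (a : ℝ)).fun_neg
    simpa using (h1.exp).const_sub 1
  have hs : Tendsto (fun k : ℕ => ((2 : ℝ) ^ k)⁻¹) atTop (𝓝[≠] 0) := by
    rw [tendsto_nhdsWithin_iff]
    refine ⟨?_, Eventually.of_forall fun k => by simp⟩
    simpa using tendsto_pow_atTop_nhds_zero_of_lt_one (r := (2⁻¹ : ℝ)) (by norm_num) (by norm_num)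
  have h := (hasDerivAt_iff_tendsto_slope.1 hd).comp hs
  have h' := ENNReal.tendsto_ofReal h
  rw [ENNReal.ofReal_coe_nnreal] at h'
  refine h'.congr fun k => ?_
  simp only [Function.comp, slope_def_field, expQuot]
  have e : (a : ℝ≥0∞) / 2 ^ k = ENNReal.ofReal (a * (2 ^ k : ℝ)⁻¹) := by
    rw [ENNReal.ofReal_mul a.coe_nonneg, ENNReal.ofReal_coe_nnreal, ENNReal.ofReal_inv_of_pos
      (by positivity), ENNReal.ofReal_pow (by norm_num), ENNReal.ofReal_ofNat, div_eq_mul_inv]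
  rw [e, expNeg_ofReal (by positivity), ← ENNReal.ofReal_one,
    ← ENNReal.ofReal_sub _ (Real.exp_nonneg _)]
  have e2 : (2 : ℝ≥0∞) ^ k = ENNReal.ofReal (2 ^ k) := by
    rw [ENNReal.ofReal_pow (by norm_num), ENNReal.ofReal_ofNat]
  rw [e2, ← ENNReal.ofReal_mul (by positivity)]
  congr 1
  simp
  ring

lemma iSup_expQuot (a : ℝ≥0∞) : ⨆ k, expQuot k a = a :=
  tendsto_nhds_unique (tendsto_atTop_iSup (expQuot_monotone a)) (tendsto_expQuot a)

@[fun_prop]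
lemma measurable_expQuot (k : ℕ) : Measurable (expQuot k) := by
  unfold expQuot; fun_prop

/-- After integration this makes e^{-Σg}·Σu a limit of differences of Laplace functionals, to which
the explicit formula applies. -/
lemma expQuot_eq (k : ℕ) (a b : ℝ≥0∞) :
    expNeg a * expQuot k b = 2 ^ k * (expNeg a - expNeg (a + b / 2 ^ k)) := by
  rw [expQuot, expNeg_add, mul_left_comm, ENNReal.mul_sub (fun _ _ => expNeg_ne_top a), mul_one]

/-- The quotient increases in its index and in its argument, so the diagonal is cofinal in the
double family. -/
lemma iSup_expQuot_of_monotone {c : ℕ → ℝ≥0∞} (hc : Monotone c) :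
    ⨆ k, expQuot k (c k) = ⨆ k, c k := by
  refine le_antisymm (iSup_mono fun k => expQuot_le k _) (iSup_le fun m => ?_)
  rw [← iSup_expQuot (c m)]
  refine iSup_le fun k => ?_
  refine le_trans ?_ (le_iSup _ (max k m))
  exact (expQuot_monotone _ (le_max_left k m)).trans (expQuot_mono _ (hc (le_max_right k m)))

/-! ### Counting measures of random point families -/

lemma lintegral_config {ι : Type*} (x : ι → ℂ) (f : ℂ → ℝ≥0∞) :
    ∫⁻ z, f z ∂config x = ∑' i, f (x i) := by
  simp [config, lintegral_sum_measure]

lemma config_apply {ι : Type*} (x : ι → ℂ) {B : Set ℂ} (hB : MeasurableSet B) :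
    config x B = ∑' i, B.indicator 1 (x i) := by
  rw [← lintegral_indicator_one hB, lintegral_config]

lemma measurable_config {Ω ι : Type*} [MeasurableSpace Ω] [Countable ι] {X : ι → Ω → ℂ}
    (hX : ∀ i, Measurable (X i)) : Measurable fun ω => config fun i => X i ω := by
  refine Measure.measurable_of_measurable_coe _ fun B hB => ?_
  simp_rw [config_apply _ hB]
  exact Measurable.tsum fun i => (measurable_one.indicator hB).comp (hX i)

/-! ### The Laplace functional of a Poisson process -/

/-- The Laplace functional `h ↦ exp(-lam ∫ (1 - e^{-h}))` of the homogeneous Poisson process. -/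
def poissonLaplace (lam : ℝ≥0) (h : ℂ → ℝ≥0∞) : ℝ≥0∞ :=
  expNeg (lam * ∫⁻ z, (1 - expNeg (h z)))

/-- The generating function of the Poisson law evaluated at e^{-t}. -/
lemma lintegral_expNeg_poissonMeasure (r t : ℝ≥0) :
    ∫⁻ n : ℕ, expNeg (t * n) ∂poissonMeasure r = expNeg (r * (1 - expNeg t)) := by
  rw [poissonMeasure, lintegral_sum_measure]
  simp only [lintegral_smul_measure, lintegral_dirac, smul_eq_mul]
  have h1 : ∀ n : ℕ, ENNReal.ofReal (Real.exp (-r) * r ^ n / n.factorial) * expNeg (t * n) =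
      ENNReal.ofReal (Real.exp (-r) * ((r * Real.exp (-t)) ^ n / n.factorial)) := by
    intro n
    have : (t : ℝ≥0∞) * n = ((t * n : ℝ≥0) : ℝ≥0∞) := by push_cast; rfl
    rw [this, expNeg_coe, ← ENNReal.ofReal_mul (by positivity), mul_pow, ← Real.exp_nat_mul]
    congr 1
    push_cast
    rw [show -((t : ℝ) * n) = n * -t by ring]
    ring
  simp_rw [h1]
  have hs : HasSum (fun n : ℕ => Real.exp (-r) * ((r * Real.exp (-t)) ^ n / n.factorial))
      (Real.exp (-r) * Real.exp (r * Real.exp (-t))) := by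
    refine HasSum.mul_left _ ?_
    have := NormedSpace.expSeries_div_hasSum_exp (𝔸 := ℝ) (r * Real.exp (-t))
    rwa [← Real.exp_eq_exp_ℝ] at this
  rw [← ENNReal.ofReal_tsum_of_nonneg (fun n => by positivity) hs.summable, hs.tsum_eq,
    ← Real.exp_add, expNeg_coe, ← ENNReal.ofReal_one, ← ENNReal.ofReal_sub _ (Real.exp_nonneg _),
    ← ENNReal.ofReal_coe_nnreal, ← ENNReal.ofReal_mul r.coe_nonneg, expNeg_ofReal]
  · congr 2; ring
  · have : Real.exp (-t) ≤ 1 := Real.exp_le_one_iff.2 (by simp)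
    exact mul_nonneg r.coe_nonneg (by linarith)

/-- At most one indicator is nonzero at z, so the nonlinear map a ↦ 1 - e^{-a} passes through the
sum. -/
lemma one_sub_expNeg_sum_indicator {n : ℕ} {D : Fin n → Set ℂ}
    (hdisj : Pairwise fun k l => Disjoint (D k) (D l)) (t : Fin n → ℝ≥0∞) (z : ℂ) :
    1 - expNeg (∑ k, (D k).indicator (fun _ => t k) z) =
      ∑ k, (D k).indicator (fun _ => 1 - expNeg (t k)) z := by
  by_cases h : ∃ k, z ∈ D k
  · obtain ⟨k, hk⟩ := h
    have hne : ∀ l, l ≠ k → z ∉ D l := fun l hl hz =>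
      Set.disjoint_left.1 (hdisj hl) hz hk
    rw [Finset.sum_eq_single k (fun l _ hl => by simp [hne l hl]) (by simp),
      Finset.sum_eq_single k (fun l _ hl => by simp [hne l hl]) (by simp)]
    simp [hk]
  · push Not at h
    simp [h]

/-- The sum over points is a linear combination of counts in disjoint sets; independence factorizes
the expectation into Poisson generating functions. -/
lemma IsPoissonProcess.laplace_sum_indicator {Ω : Type*} [MeasurableSpace Ω] {P : Measure Ω}
    {lam : ℝ≥0} {Z : ℕ → Ω → ℂ} (hZ : IsPoissonProcess lam Z P) {n : ℕ} {D : Fin n → Set ℂ}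
    (hD : ∀ k, MeasurableSet (D k)) (hfin : ∀ k, volume (D k) ≠ ∞)
    (hdisj : Pairwise fun k l => Disjoint (D k) (D l)) (t : Fin n → ℝ≥0) :
    ∫⁻ ω, expNeg (∑' i, ∑ k, (D k).indicator (fun _ => (t k : ℝ≥0∞)) (Z i ω)) ∂P =
      poissonLaplace lam fun z => ∑ k, (D k).indicator (fun _ => (t k : ℝ≥0∞)) z := by
  have hmeas : ∀ k, Measurable fun ω => config (fun i => Z i ω) (D k) := fun k =>
    (Measure.measurable_coe (hD k)).comp (measurable_config hZ.measurable)
  have h1 : ∀ ω, ∑' i, ∑ k, (D k).indicator (fun _ => (t k : ℝ≥0∞)) (Z i ω) =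
      ∑ k, (t k : ℝ≥0∞) * config (fun i => Z i ω) (D k) := by
    intro ω
    rw [Summable.tsum_finsetSum fun _ _ => ENNReal.summable]
    refine Finset.sum_congr rfl fun k _ => ?_
    rw [config_apply _ (hD k), ← ENNReal.tsum_mul_left]
    refine tsum_congr fun i => ?_
    by_cases h : Z i ω ∈ D k <;> simp [h]
  simp_rw [h1, expNeg_sum]
  have hind := (hZ.indep_count n D hD hdisj).comp
    (fun k (a : ℝ≥0∞) => expNeg (t k * a)) (fun k => by fun_prop)
  have h2 := lintegral_prod_eq_prod_lintegral_of_indepFun Finset.univ _ hind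
    (fun k => Measurable.comp (by fun_prop) (hmeas k))
  simp only [Function.comp_def] at h2
  rw [h2]
  have h3 : ∀ k, ∫⁻ ω, expNeg (t k * config (fun i => Z i ω) (D k)) ∂P =
      expNeg (lam * (volume (D k) * (1 - expNeg (t k)))) := by
    intro k
    have hg : Measurable fun a : ℝ≥0∞ => expNeg (t k * a) := by fun_prop
    rw [← lintegral_map (μ := P) hg (hmeas k), hZ.law_count _ (hD k) (hfin k),
      lintegral_map hg (by fun_prop), lintegral_expNeg_poissonMeasure, ENNReal.coe_mul,
      ENNReal.coe_toNNReal (hfin k), mul_assoc]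
  simp_rw [h3, poissonLaplace]
  rw [← expNeg_sum, ← Finset.mul_sum]
  congr 2
  simp_rw [one_sub_expNeg_sum_indicator hdisj]
  rw [lintegral_finsetSum _ fun k _ => measurable_const.indicator (hD k)]
  refine Finset.sum_congr rfl fun k _ => ?_
  rw [lintegral_indicator_const (hD k), mul_comm]

lemma exists_eq_sum_indicator (f : SimpleFunc ℂ ℝ≥0∞) (hf : ∀ z, f z ≠ ∞)
    (hfin : volume (Function.support f) ≠ ∞) :
    ∃ (n : ℕ) (D : Fin n → Set ℂ) (t : Fin n → ℝ≥0), (∀ k, MeasurableSet (D k)) ∧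
      (∀ k, volume (D k) ≠ ∞) ∧ (Pairwise fun k l => Disjoint (D k) (D l)) ∧
      ∀ z, f z = ∑ k, (D k).indicator (fun _ => (t k : ℝ≥0∞)) z := by
  classical
  set s := f.range.filter (· ≠ 0)
  set e := s.equivFin
  refine ⟨s.card, fun k => f ⁻¹' {(e.symm k : ℝ≥0∞)}, fun k => (e.symm k : ℝ≥0∞).toNNReal,
    fun k => f.measurableSet_fiber _, fun k => ?_, fun k l hkl => ?_, fun z => ?_⟩
  · refine ne_top_of_le_ne_top hfin (measure_mono fun z hz => ?_)
    have := (Finset.mem_filter.1 (e.symm k).2).2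
    simp only [Set.mem_preimage, Set.mem_singleton_iff] at hz
    simpa [hz] using this
  · refine Set.disjoint_left.2 fun z hz hz' => hkl ?_
    simp only [Set.mem_preimage, Set.mem_singleton_iff] at hz hz'
    exact e.symm.injective (Subtype.ext (hz.symm.trans hz'))
  · by_cases h0 : f z = 0
    · rw [h0, Finset.sum_eq_zero]
      intro k _
      refine Set.indicator_of_notMem (fun hz => ?_) _
      simp only [Set.mem_preimage, Set.mem_singleton_iff] at hz
      exact (Finset.mem_filter.1 (e.symm k).2).2 (hz.symm.trans h0)
    · have hmem : f z ∈ s := Finset.mem_filter.2 ⟨f.mem_range_self z, h0⟩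
      rw [Finset.sum_eq_single (e ⟨f z, hmem⟩)]
      · simp [ENNReal.coe_toNNReal (hf z)]
      · intro k _ hk
        refine Set.indicator_of_notMem (fun hz => hk ?_) _
        simp only [Set.mem_preimage, Set.mem_singleton_iff] at hz
        rw [← e.symm_apply_eq]
        exact Subtype.ext hz.symm
      · simp

lemma tendsto_lintegral_expNeg {Ω : Type*} [MeasurableSpace Ω] {P : Measure Ω}
    [IsFiniteMeasure P] {a : ℕ → Ω → ℝ≥0∞} {b : Ω → ℝ≥0∞} (ha : ∀ n, Measurable (a n))
    (h : ∀ ω, Tendsto (fun n => a n ω) atTop (𝓝 (b ω))) :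
    Tendsto (fun n => ∫⁻ ω, expNeg (a n ω) ∂P) atTop (𝓝 (∫⁻ ω, expNeg (b ω) ∂P)) := by
  refine tendsto_lintegral_of_dominated_convergence (fun _ => 1)
    (fun n => measurable_expNeg.comp (ha n)) (fun n => ae_of_all _ fun ω => expNeg_le_one _)
    (by simp) (ae_of_all _ fun ω => (continuous_expNeg.tendsto _).comp (h ω))

lemma tendsto_poissonLaplace {lam : ℝ≥0} {f : ℕ → ℂ → ℝ≥0∞} {h : ℂ → ℝ≥0∞}
    (hf : ∀ n, Measurable (f n)) (hmono : ∀ z, Monotone fun n => f n z)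
    (hlim : ∀ z, Tendsto (fun n => f n z) atTop (𝓝 (h z))) :
    Tendsto (fun n => poissonLaplace lam (f n)) atTop (𝓝 (poissonLaplace lam h)) := by
  refine (continuous_expNeg.tendsto _).comp (ENNReal.Tendsto.const_mul ?_ (by simp))
  refine lintegral_tendsto_of_tendsto_of_monotone (fun n => (by fun_prop)) (ae_of_all _ fun z => ?_)
    (ae_of_all _ fun z => ?_)
  · exact fun m n hmn => tsub_le_tsub_left (expNeg_antitone (hmono z hmn)) 1
  · exact ENNReal.Tendsto.sub tendsto_const_nhds ((continuous_expNeg.tendsto _).comp (hlim z))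
      (by simp)

lemma tendsto_tsum_of_monotone {x : ℕ → ℂ} {f : ℕ → ℂ → ℝ≥0∞} {h : ℂ → ℝ≥0∞}
    (hf : ∀ n, Measurable (f n)) (hmono : ∀ z, Monotone fun n => f n z)
    (hlim : ∀ z, Tendsto (fun n => f n z) atTop (𝓝 (h z))) :
    Tendsto (fun n => ∑' i, f n (x i)) atTop (𝓝 (∑' i, h (x i))) := by
  simp_rw [← lintegral_config]
  exact lintegral_tendsto_of_tendsto_of_monotone (fun n => (hf n).aemeasurable)
    (ae_of_all _ fun z => hmono z) (ae_of_all _ fun z => hlim z)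

/-- The formula for the Laplace functional is stable under monotone limits. -/
lemma laplace_of_approx {Ω : Type*} [MeasurableSpace Ω] {P : Measure Ω} [IsFiniteMeasure P]
    {lam : ℝ≥0} {Z : ℕ → Ω → ℂ} (hZ : ∀ i, Measurable (Z i)) {h : ℂ → ℝ≥0∞}
    {f : ℕ → ℂ → ℝ≥0∞} (hf : ∀ n, Measurable (f n)) (hmono : ∀ z, Monotone fun n => f n z)
    (hlim : ∀ z, Tendsto (fun n => f n z) atTop (𝓝 (h z)))
    (heq : ∀ n, ∫⁻ ω, expNeg (∑' i, f n (Z i ω)) ∂P = poissonLaplace lam (f n)) :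
    ∫⁻ ω, expNeg (∑' i, h (Z i ω)) ∂P = poissonLaplace lam h := by
  refine tendsto_nhds_unique ?_ (tendsto_poissonLaplace hf hmono hlim)
  simp_rw [← heq]
  exact tendsto_lintegral_expNeg
    (fun n => Measurable.tsum fun i => (hf n).comp (hZ i))
    (fun ω => tendsto_tsum_of_monotone hf hmono hlim)

lemma IsPoissonProcess.laplace {Ω : Type*} [MeasurableSpace Ω] {P : Measure Ω}
    [IsFiniteMeasure P] {lam : ℝ≥0} {Z : ℕ → Ω → ℂ} (hZ : IsPoissonProcess lam Z P)
    {h : ℂ → ℝ≥0∞} (hh : Measurable h) :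
    ∫⁻ ω, expNeg (∑' i, h (Z i ω)) ∂P = poissonLaplace lam h := by
  -- Restriction to balls gives the level sets finite area, the only case in which the law of the
  -- counts is prescribed.
  set f : ℕ → SimpleFunc ℂ ℝ≥0∞ := fun n =>
    (SimpleFunc.eapprox h n).restrict (Metric.ball 0 n)
  have hval : ∀ n z, f n z = (Metric.ball (0 : ℂ) n).indicator (SimpleFunc.eapprox h n) z :=
    fun n z => by rw [SimpleFunc.restrict_apply _ Metric.isOpen_ball.measurableSet]
  refine laplace_of_approx hZ.measurable (f := fun n => f n) (fun n => (f n).measurable)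
    (fun z m n hmn => ?_) (fun z => ?_) (fun n => ?_)
  · simp only [hval]
    refine (Set.indicator_le_indicator (SimpleFunc.monotone_eapprox h hmn z)).trans ?_
    exact Set.indicator_le_indicator_of_subset (Metric.ball_subset_ball (by exact_mod_cast hmn))
      (fun _ => zero_le) z
  · have h1 : Tendsto (fun n => SimpleFunc.eapprox h n z) atTop (𝓝 (h z)) := by
      rw [← SimpleFunc.iSup_eapprox_apply hh z]
      exact tendsto_atTop_iSup fun m n hmn => SimpleFunc.monotone_eapprox h hmn z
    refine h1.congr' ?_
    obtain ⟨N, hN⟩ := exists_nat_gt ‖z‖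
    filter_upwards [eventually_ge_atTop N] with n hn
    rw [hval, Set.indicator_of_mem]
    rw [mem_ball_zero_iff]
    exact hN.trans_le (by exact_mod_cast hn)
  · obtain ⟨m, D, t, hD, hfin, hdisj, heq⟩ := exists_eq_sum_indicator (f n)
      (fun z => by
        rw [hval]
        refine (lt_of_le_of_lt (Set.indicator_le_self _ _ _) (SimpleFunc.eapprox_lt_top h n z)).ne)
      (by
        refine ne_top_of_le_ne_top (measure_ball_lt_top (x := (0 : ℂ)) (r := n)).ne
          (measure_mono fun z hz => ?_)
        by_contra hz'
        rw [Function.mem_support, hval, Set.indicator_of_notMem hz'] at hz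
        exact hz rfl)
    simp_rw [heq]
    rw [show ⇑(f n) = _ from funext heq]
    exact hZ.laplace_sum_indicator hD hfin hdisj t

/-! ### The Mecke formula, by differentiating the Laplace functional -/

lemma tsum_eq_add_tsum_ne (f : ℕ → ℝ≥0∞) (i : ℕ) :
    ∑' j, f j = f i + ∑' j : {j : ℕ // j ≠ i}, f j := by
  have h := (ENNReal.summable (f := f ∘ ((↑) : ({i} : Set ℕ) → ℕ))).tsum_add_tsum_compl
    (ENNReal.summable (f := f ∘ ((↑) : (({i} : Set ℕ)ᶜ : Set ℕ) → ℕ)))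
  rw [← h, tsum_singleton i f]
  rfl

lemma expQuot_div (k : ℕ) (a : ℝ≥0∞) : expQuot k a / 2 ^ k = 1 - expNeg (a / 2 ^ k) := by
  rw [expQuot, mul_comm, ENNReal.mul_div_cancel_right (by simp) (by simp)]

/-- The difference quotient of the Laplace functional at g in the direction u; as k grows it tends
to the derivative L(g)·λ∫e^{-g}u. The inner quotient comes from splitting 1 - e^{-(g+u/2ᵏ)} into 1 -
e^{-g} and e^{-g}(1 - e^{-u/2ᵏ}). -/
lemma poissonLaplace_add_div {lam : ℝ≥0} {g u : ℂ → ℝ≥0∞} (hg : Measurable g)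
    (hu : Measurable u) (k : ℕ) :
    2 ^ k * (poissonLaplace lam g - poissonLaplace lam fun z => g z + u z / 2 ^ k) =
      poissonLaplace lam g * expQuot k (lam * ∫⁻ z, expNeg (g z) * expQuot k (u z)) := by
  rw [poissonLaplace, expQuot_eq, poissonLaplace]
  congr 4
  rw [mul_div_assoc, ← mul_add]
  congr 1
  rw [div_eq_mul_inv, ← lintegral_mul_const _ (by fun_prop), ← lintegral_add_left (by fun_prop)]
  refine lintegral_congr fun z => ?_
  rw [one_sub_expNeg_add, mul_assoc, ← div_eq_mul_inv, expQuot_div]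

/-- The Laplace form of the Mecke formula. -/
lemma IsPoissonProcess.mecke_laplace {Ω : Type*} [MeasurableSpace Ω] {P : Measure Ω}
    [IsFiniteMeasure P] {lam : ℝ≥0} {Z : ℕ → Ω → ℂ} (hZ : IsPoissonProcess lam Z P)
    {g : ℂ → ℝ≥0∞} (hg : Measurable g) (hgtop : ∀ z, g z ≠ ∞) {C : Set ℂ}
    (hC : MeasurableSet C) :
    ∫⁻ ω, ∑' i, C.indicator 1 (Z i ω) * expNeg (∑' j : {j : ℕ // j ≠ i}, g (Z j ω)) ∂P =
      lam * volume C * poissonLaplace lam g := by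
  -- u is e^{g} on C: the factor u(Zᵢ) cancels the contribution of the i-th point to e^{-Σg} and
  -- leaves the sum over j ≠ i. This needs g finite.
  set u : ℂ → ℝ≥0∞ := C.indicator fun z => (expNeg (g z))⁻¹
  have hu : Measurable u := Measurable.indicator (by fun_prop) hC
  have hmg : Measurable fun ω => ∑' i, g (Z i ω) :=
    Measurable.tsum fun i => hg.comp (hZ.measurable i)
  have hmu : Measurable fun ω => ∑' i, u (Z i ω) :=
    Measurable.tsum fun i => hu.comp (hZ.measurable i)
  have hpt : ∀ ω, ∑' i, C.indicator 1 (Z i ω) * expNeg (∑' j : {j : ℕ // j ≠ i}, g (Z j ω)) =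
      expNeg (∑' i, g (Z i ω)) * ⨆ k, expQuot k (∑' i, u (Z i ω)) := by
    intro ω
    rw [iSup_expQuot, ← ENNReal.tsum_mul_left]
    refine tsum_congr fun i => ?_
    rw [tsum_eq_add_tsum_ne _ i, expNeg_add]
    by_cases h : Z i ω ∈ C
    · simp only [u, Set.indicator_of_mem h, Pi.one_apply, one_mul]
      rw [mul_right_comm, ENNReal.mul_inv_cancel (expNeg_ne_zero (hgtop _)) (expNeg_ne_top _),
        one_mul]
    · simp [u, h]
  -- Monotone convergence in k replaces differentiation under the integral and needs no
  -- integrability.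
  simp_rw [hpt, ENNReal.mul_iSup]
  refine (lintegral_iSup
    (f := fun k ω => expNeg (∑' i, g (Z i ω)) * expQuot k (∑' i, u (Z i ω)))
    (fun k => by fun_prop) (fun k l hkl ω => mul_le_mul_right (expQuot_monotone _ hkl) _)).trans ?_
  have hk : ∀ k, ∫⁻ ω, expNeg (∑' i, g (Z i ω)) * expQuot k (∑' i, u (Z i ω)) ∂P =
      poissonLaplace lam g * expQuot k (lam * ∫⁻ z, expNeg (g z) * expQuot k (u z)) := by
    intro k
    have hadd : ∀ ω, ∑' i, g (Z i ω) + (∑' i, u (Z i ω)) / 2 ^ k =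
        ∑' i, (g (Z i ω) + u (Z i ω) / 2 ^ k) := by
      intro ω
      rw [ENNReal.tsum_add, div_eq_mul_inv, ← ENNReal.tsum_mul_right]
      rfl
    rw [← poissonLaplace_add_div hg hu, ← hZ.laplace hg,
      ← hZ.laplace (h := fun z => g z + u z / 2 ^ k) (by fun_prop)]
    simp_rw [expQuot_eq, hadd]
    have hm2 : Measurable fun ω => ∑' i, (g (Z i ω) + u (Z i ω) / 2 ^ k) := by
      simp_rw [← hadd]; fun_prop
    rw [lintegral_const_mul _ (by fun_prop), lintegral_sub (by fun_prop)]
    · exact ((lintegral_mono fun ω => expNeg_le_one _).trans_lt (by simp)).ne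
    · refine ae_of_all _ fun ω => expNeg_antitone (ENNReal.tsum_le_tsum fun i => le_self_add)
  simp_rw [hk]
  rw [← ENNReal.mul_iSup, iSup_expQuot_of_monotone, ← ENNReal.mul_iSup,
    ← lintegral_iSup (f := fun k z => expNeg (g z) * expQuot k (u z)) (fun k => by fun_prop)
      (fun k l hkl z => mul_le_mul_right (expQuot_monotone _ hkl) _), mul_comm]
  · congr 2
    rw [← lintegral_indicator_one hC]
    refine lintegral_congr fun z => ?_
    rw [← ENNReal.mul_iSup, iSup_expQuot]
    by_cases h : z ∈ C
    · simp only [u, Set.indicator_of_mem h, Pi.one_apply]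
      exact ENNReal.mul_inv_cancel (expNeg_ne_zero (hgtop _)) (expNeg_ne_top _)
    · simp [u, h]
  · exact fun k l hkl => mul_le_mul_right
      (lintegral_mono fun z => mul_le_mul_right (expQuot_monotone _ hkl) _) _

/-! ### The reduced Palm distribution of a Poisson process -/

/-- The right side of the Palm identity is a measure in A, namely the sum over i of the images of P
weighted by 1_B(Zᵢ). Equality on sets is thus equality of measures, and integrals follow. -/
lemma IsReducedPalm.lintegral {Ω : Type*} [MeasurableSpace Ω] {P : Measure Ω}
    {lam : ℝ≥0} {a : ℂ} {Z : ℕ → Ω → ℂ} {Q : Measure (Measure ℂ)}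
    (hQ : IsReducedPalm lam a Z P Q) (hZ : ∀ i, Measurable (Z i)) {B : Set ℂ}
    (hB : MeasurableSet B) (hfin : volume B ≠ ∞) {F : Measure ℂ → ℝ≥0∞} (hF : Measurable F) :
    lam * volume B * ∫⁻ φ, F φ ∂Q =
      ∫⁻ ω, ∑' i : ℕ, B.indicator 1 (Z i ω) *
        F (config fun j : {j : ℕ // j ≠ i} => Z j ω - Z i ω + a) ∂P := by
  have hc : ∀ i, Measurable fun ω => config fun j : {j : ℕ // j ≠ i} => Z j ω - Z i ω + a :=
    fun i => measurable_config fun j => ((hZ j).sub (hZ i)).add_const a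
  have hb : ∀ i, Measurable fun ω => B.indicator (1 : ℂ → ℝ≥0∞) (Z i ω) :=
    fun i => (measurable_one.indicator hB).comp (hZ i)
  have key : ∀ G : Measure ℂ → ℝ≥0∞, Measurable G →
      ∫⁻ φ, G φ ∂(Measure.sum fun i => (P.withDensity fun ω => B.indicator 1 (Z i ω)).map
        fun ω => config fun j : {j : ℕ // j ≠ i} => Z j ω - Z i ω + a) =
      ∫⁻ ω, ∑' i : ℕ, B.indicator 1 (Z i ω) *
        G (config fun j : {j : ℕ // j ≠ i} => Z j ω - Z i ω + a) ∂P := by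
    intro G hG
    rw [lintegral_sum_measure, lintegral_tsum]
    swap
    · exact fun i => ((hb i).mul (hG.comp (hc i))).aemeasurable
    refine tsum_congr fun i => ?_
    rw [lintegral_map hG (hc i)]
    exact lintegral_withDensity_eq_lintegral_mul _ (hb i) (hG.comp (hc i))
  have heq : (lam * volume B) • Q =
      Measure.sum fun i => (P.withDensity fun ω => B.indicator 1 (Z i ω)).map
        fun ω => config fun j : {j : ℕ // j ≠ i} => Z j ω - Z i ω + a := by
    ext A hA
    rw [Measure.smul_apply, smul_eq_mul, hQ B hB hfin A hA, ← lintegral_indicator_one hA,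
      key _ (measurable_one.indicator hA)]
  rw [← key F hF, ← heq, lintegral_smul_measure, smul_eq_mul]

/-! ### Slivnyak's theorem for continuous test functions of compact support -/

/-- Uniform continuity gives ε. Shifts shorter than 1 keep the support within a ball enlarged by 1,
so the radius does not depend on ε and the error has integral proportional to ε. -/
lemma exists_modulus {f : ℂ → ℝ≥0} (hf : Continuous f) (hc : HasCompactSupport f) :
    ∃ R : ℝ, ∀ ε : ℝ≥0, 0 < ε → ∃ δ : ℝ, 0 < δ ∧ ∀ x ∈ Metric.ball (0 : ℂ) δ, ∀ y,
      (f (y - x) : ℝ≥0∞) ≤ f y + (Metric.closedBall 0 R).indicator (fun _ => (ε : ℝ≥0∞)) y ∧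
      (f y : ℝ≥0∞) ≤ f (y - x) + (Metric.closedBall 0 R).indicator (fun _ => (ε : ℝ≥0∞)) y := by
  obtain ⟨R, hR⟩ := hc.isCompact.isBounded.subset_closedBall (0 : ℂ)
  have hu : UniformContinuous f := hf.uniformContinuous_of_tendsto_cocompact hc.is_zero_at_infty
  refine ⟨R + 1, fun ε hε => ?_⟩
  obtain ⟨δ, hδ, h⟩ := Metric.uniformContinuous_iff.1 hu ε hε
  refine ⟨min δ 1, by positivity, fun x hx y => ?_⟩
  rw [mem_ball_zero_iff, lt_min_iff] at hx
  by_cases hy : y ∈ Metric.closedBall (0 : ℂ) (R + 1)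
  · simp only [Set.indicator_of_mem hy]
    have h1 := h (a := y - x) (b := y) (by simpa [dist_eq_norm] using hx.1)
    rw [NNReal.dist_eq, abs_lt] at h1
    constructor
    · exact_mod_cast (show (f (y - x) : ℝ) ≤ f y + ε by linarith)
    · exact_mod_cast (show (f y : ℝ) ≤ f (y - x) + ε by linarith)
  · have hzero : ∀ z : ℂ, R < ‖z‖ → f z = 0 := fun z hz => by
      refine image_eq_zero_of_notMem_tsupport fun hz' => ?_
      have := hR hz'
      rw [mem_closedBall_zero_iff] at this
      linarith
    rw [mem_closedBall_zero_iff, not_le] at hy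
    have h2 : R < ‖y - x‖ := by
      have := norm_sub_norm_le y x
      linarith
    simp [hzero _ h2, hzero y (by linarith)]

lemma poissonLaplace_mul_le {lam : ℝ≥0} {g k : ℂ → ℝ≥0∞} (hg : Measurable g) :
    poissonLaplace lam g * expNeg (lam * ∫⁻ z, k z) ≤ poissonLaplace lam fun z => g z + k z := by
  rw [poissonLaplace, poissonLaplace, ← expNeg_add, ← mul_add, ← lintegral_add_left (by fun_prop)]
  refine expNeg_antitone ?_
  gcongr
  exact one_sub_expNeg_add_le _ _

lemma poissonLaplace_antitone {lam : ℝ≥0} {g h : ℂ → ℝ≥0∞} (hgh : ∀ z, g z ≤ h z) :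
    poissonLaplace lam h ≤ poissonLaplace lam g := by
  refine expNeg_antitone ?_
  gcongr with z
  exact expNeg_antitone (hgh z)

lemma le_of_forall_mul_expNeg_le {x y c : ℝ≥0∞} (hc : c ≠ ∞)
    (h : ∀ ε : ℝ≥0, 0 < ε → x * expNeg (ε * c) ≤ y) : x ≤ y := by
  have ht : Tendsto (fun ε : ℝ≥0 => x * expNeg (ε * c)) (𝓝[>] 0) (𝓝 (x * expNeg ((0 : ℝ≥0) * c))) := by
    refine ENNReal.Tendsto.const_mul ?_ (by simp)
    refine (continuous_expNeg.tendsto _).comp (ENNReal.Tendsto.mul_const ?_ (Or.inr hc))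
    exact (ENNReal.tendsto_coe.2 tendsto_id).mono_left nhdsWithin_le_nhds
  simp only [ENNReal.coe_zero, zero_mul, expNeg_zero, mul_one] at ht
  exact le_of_tendsto ht (eventually_mem_nhdsWithin.mono fun ε hε => h ε hε)

/-- The Palm identity is used with B a small ball at the origin. For Zᵢ ∈ B, replacing f(Zⱼ - Zᵢ) by
f(Zⱼ) costs at most `k ε`, so the Mecke formula for f - k and f + k bounds the Palm integral from
both sides. The factor λ·area(B) cancels, and then ε tends to 0. -/
lemma IsReducedPalm.laplace_of_hasCompactSupport {Ω : Type*} [MeasurableSpace Ω] {P : Measure Ω}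
    [IsFiniteMeasure P] {lam : ℝ≥0} (hlam : 0 < lam) {a : ℂ} {Z : ℕ → Ω → ℂ}
    {Q : Measure (Measure ℂ)} (hQ : IsReducedPalm lam a Z P Q) (hZ : IsPoissonProcess lam Z P)
    {h : ℂ → ℝ≥0} (hh : Continuous h) (hc : HasCompactSupport h) :
    ∫⁻ φ, expNeg (∫⁻ z, h z ∂φ) ∂Q = poissonLaplace lam fun z => h z := by
  set f : ℂ → ℝ≥0 := fun z => h (z + a)
  have hf : Continuous f := by fun_prop
  have hfc : HasCompactSupport f := hc.comp_homeomorph (Homeomorph.addRight a)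
  -- Moving the prescribed point from a to the origin is harmless, Lebesgue measure being
  -- translation invariant.
  have hA : poissonLaplace lam (fun z => (h z : ℝ≥0∞)) = poissonLaplace lam fun z => f z := by
    unfold poissonLaplace
    rw [← lintegral_add_right_eq_self (fun z => 1 - expNeg (h z : ℝ≥0∞)) a]
  obtain ⟨R, hR⟩ := exists_modulus hf hfc
  set k : ℝ≥0 → ℂ → ℝ≥0∞ := fun ε => (Metric.closedBall 0 R).indicator fun _ => (ε : ℝ≥0∞)
  have hkm : ∀ ε, Measurable (k ε) := fun ε => measurable_const.indicator measurableSet_closedBall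
  have hktop : ∀ ε z, k ε z ≠ ∞ := fun ε z =>
    ((Set.indicator_le_self _ _ z).trans_lt ENNReal.coe_lt_top).ne
  set c : ℝ≥0∞ := lam * volume (Metric.closedBall (0 : ℂ) R)
  have hctop : c ≠ ∞ := ENNReal.mul_ne_top (by simp) (measure_closedBall_lt_top).ne
  have hkint : ∀ ε, lam * ∫⁻ z, k ε z = ε * c := fun ε => by
    rw [lintegral_indicator_const measurableSet_closedBall, mul_left_comm]
  have hF : Measurable fun φ : Measure ℂ => expNeg (∫⁻ z, h z ∂φ) :=
    measurable_expNeg.comp (Measure.measurable_lintegral (by fun_prop))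
  have hball : ∀ δ : ℝ, 0 < δ → (lam : ℝ≥0∞) * volume (Metric.ball (0 : ℂ) δ) ≠ 0 := fun δ hδ =>
    mul_ne_zero (by exact_mod_cast hlam.ne') (Metric.measure_ball_pos _ _ hδ).ne'
  have hball' : ∀ δ : ℝ, (lam : ℝ≥0∞) * volume (Metric.ball (0 : ℂ) δ) ≠ ∞ := fun δ =>
    ENNReal.mul_ne_top (by simp) (measure_ball_lt_top).ne
  have hpalm := fun δ : ℝ => hQ.lintegral hZ.measurable (B := Metric.ball 0 δ)
    Metric.isOpen_ball.measurableSet (measure_ball_lt_top).ne hF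
  simp only [lintegral_config] at hpalm
  have hval : ∀ ω (i j : ℕ), h (Z j ω - Z i ω + a) = f (Z j ω - Z i ω) := fun _ _ _ => rfl
  simp only [hval] at hpalm
  have hmecke := fun (δ : ℝ) (g : ℂ → ℝ≥0∞) (hg : Measurable g) (hgt : ∀ z, g z ≠ ∞) =>
    hZ.mecke_laplace hg hgt (C := Metric.ball 0 δ) Metric.isOpen_ball.measurableSet
  have hcomp : ∀ (B : Set ℂ) (ω : Ω) (u v : ℕ → ℝ≥0∞), (∀ i, Z i ω ∈ B → u i ≤ v i) →
      ∑' i, B.indicator 1 (Z i ω) * u i ≤ ∑' i, B.indicator 1 (Z i ω) * v i := by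
    intro B ω u v huv
    refine ENNReal.tsum_le_tsum fun i => ?_
    by_cases hi : Z i ω ∈ B
    · gcongr; exact huv i hi
    · simp [hi]
  rw [hA]
  refine le_antisymm ?_ ?_
  · refine le_of_forall_mul_expNeg_le hctop fun ε hε => ?_
    obtain ⟨δ, hδ, hmod⟩ := hR ε hε
    have hgm : Measurable fun z => (f z : ℝ≥0∞) - k ε z := by fun_prop
    have h1 : ∫⁻ φ, expNeg (∫⁻ z, h z ∂φ) ∂Q ≤ poissonLaplace lam fun z => f z - k ε z := by
      rw [← ENNReal.mul_le_mul_iff_right (hball δ hδ) (hball' δ), hpalm,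
        ← hmecke δ _ hgm fun z => (tsub_le_self.trans_lt ENNReal.coe_lt_top).ne]
      refine lintegral_mono fun ω => hcomp _ _ _ _ fun i hi => expNeg_antitone ?_
      refine ENNReal.tsum_le_tsum fun j => ?_
      rw [tsub_le_iff_right]
      exact (hmod _ hi _).2
    calc _ ≤ (poissonLaplace lam fun z => f z - k ε z) * expNeg (ε * c) := by gcongr
      _ ≤ poissonLaplace lam fun z => (f z - k ε z) + k ε z := by
        rw [← hkint]; exact poissonLaplace_mul_le hgm
      _ ≤ _ := poissonLaplace_antitone fun z => le_tsub_add
  · refine le_of_forall_mul_expNeg_le hctop fun ε hε => ?_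
    obtain ⟨δ, hδ, hmod⟩ := hR ε hε
    rw [← hkint]
    refine (poissonLaplace_mul_le (by fun_prop)).trans ?_
    rw [← ENNReal.mul_le_mul_iff_right (hball δ hδ) (hball' δ), hpalm,
      ← hmecke δ _ (by fun_prop) fun z => ENNReal.add_ne_top.2 ⟨ENNReal.coe_ne_top, hktop ε z⟩]
    refine lintegral_mono fun ω => hcomp _ _ _ _ fun i hi => expNeg_antitone ?_
    exact ENNReal.tsum_le_tsum fun j => (hmod _ hi _).1

/-! ### Intensity bound and extension to measurable test functions -/

lemma poissonLaplace_zero (lam : ℝ≥0) : poissonLaplace lam (fun _ => 0) = 1 := by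
  simp [poissonLaplace]

/-- `Q.join` is the mean measure of a configuration with law Q. The mean of ∫h dφ is read off from
the Laplace functional at h/2ᵏ, a difference quotient at 0; bounding each quotient by its argument
gives λ∫h. -/
lemma lintegral_join_le_of_laplace {lam : ℝ≥0} {Q : Measure (Measure ℂ)} [IsProbabilityMeasure Q]
    (hQ : ∀ h : ℂ → ℝ≥0, Continuous h → HasCompactSupport h →
      ∫⁻ φ, expNeg (∫⁻ z, h z ∂φ) ∂Q = poissonLaplace lam fun z => h z)
    {h : ℂ → ℝ≥0} (hh : Continuous h) (hc : HasCompactSupport h) :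
    ∫⁻ z, h z ∂Q.join ≤ lam * ∫⁻ z, h z := by
  have hm : Measurable fun z => (h z : ℝ≥0∞) := by fun_prop
  have hφ : Measurable fun φ : Measure ℂ => ∫⁻ z, h z ∂φ := Measure.measurable_lintegral hm
  rw [Measure.lintegral_join hm.aemeasurable]
  have h1 : ∀ φ : Measure ℂ, ∫⁻ z, h z ∂φ = ⨆ k, expQuot k (∫⁻ z, h z ∂φ) := fun φ =>
    (iSup_expQuot _).symm
  rw [lintegral_congr h1, lintegral_iSup (f := fun k (φ : Measure ℂ) => expQuot k (∫⁻ z, h z ∂φ))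
    (fun k => by fun_prop) (fun k l hkl φ => expQuot_monotone _ hkl)]
  refine iSup_le fun k => ?_
  have h2 : ∀ φ : Measure ℂ, (∫⁻ z, h z ∂φ) / 2 ^ k =
      ∫⁻ z, ((h z * ((2 : ℝ≥0) ^ k)⁻¹ : ℝ≥0) : ℝ≥0∞) ∂φ := by
    intro φ
    rw [div_eq_mul_inv, ← lintegral_mul_const _ hm]
    refine lintegral_congr fun z => ?_
    rw [ENNReal.coe_mul, ENNReal.coe_inv (by positivity)]
    simp
  have h3 : ∫⁻ φ, expQuot k (∫⁻ z, h z ∂φ) ∂Q =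
      2 ^ k * (1 - ∫⁻ φ, expNeg ((∫⁻ z, h z ∂φ) / 2 ^ k) ∂Q) := by
    unfold expQuot
    rw [lintegral_const_mul _ (by fun_prop), lintegral_sub (by fun_prop)]
    · simp
    · exact ((lintegral_mono fun ω => expNeg_le_one _).trans_lt (by simp)).ne
    · exact ae_of_all _ fun φ => expNeg_le_one _
  rw [h3]
  simp_rw [h2]
  have hk := hQ (fun z => h z * ((2 : ℝ≥0) ^ k)⁻¹) (by fun_prop)
    (HasCompactSupport.mul_right (f := h) (f' := fun _ => ((2 : ℝ≥0) ^ k)⁻¹) hc)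
  rw [hk]
  have h4 := poissonLaplace_add_div (lam := lam) (g := fun _ => 0) measurable_const hm k
  rw [poissonLaplace_zero, one_mul] at h4
  have h5 : (fun z => (0 : ℝ≥0∞) + (h z : ℝ≥0∞) / 2 ^ k) =
      fun z => ((h z * ((2 : ℝ≥0) ^ k)⁻¹ : ℝ≥0) : ℝ≥0∞) := by
    ext z
    rw [zero_add, ENNReal.coe_mul, ENNReal.coe_inv (by positivity), div_eq_mul_inv]
    simp
  rw [h5] at h4
  rw [h4]
  refine (expQuot_le _ _).trans ?_
  gcongr with z
  rw [expNeg_zero, one_mul]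
  exact expQuot_le _ _

/-- Urysohn functions between compact K and open U, with outer regularity of ν, give μ K ≤ ν K;
inner regularity of μ gives the rest. -/
lemma le_smul_of_lintegral_le {μ ν : Measure ℂ} [ν.OuterRegular] [IsFiniteMeasureOnCompacts ν]
    (h : ∀ f : ℂ → ℝ≥0, Continuous f → HasCompactSupport f → ∫⁻ z, f z ∂μ ≤ ∫⁻ z, f z ∂ν) :
    μ ≤ ν := by
  have hK : ∀ K : Set ℂ, IsCompact K → μ K ≤ ν K := by
    intro K hKc
    rw [K.measure_eq_iInf_isOpen ν]
    refine le_iInf₂ fun U hKU => le_iInf fun hU => ?_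
    obtain ⟨f, hf1, hf0, hfc, hf01⟩ := exists_continuous_one_zero_of_isCompact hKc
      hU.isClosed_compl (Set.disjoint_compl_right_iff_subset.2 hKU)
    have hc : HasCompactSupport fun z => (f z).toNNReal := hfc.comp_left (g := Real.toNNReal) (by simp)
    calc μ K = ∫⁻ z, K.indicator 1 z ∂μ := (lintegral_indicator_one hKc.measurableSet).symm
      _ ≤ ∫⁻ z, ((f z).toNNReal : ℝ≥0∞) ∂μ := by
        refine lintegral_mono fun z => ?_
        by_cases hz : z ∈ K
        · simp [hz, hf1 hz]
        · simp [hz]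
      _ ≤ ∫⁻ z, ((f z).toNNReal : ℝ≥0∞) ∂ν := h _ (by fun_prop) hc
      _ ≤ ∫⁻ z, U.indicator 1 z ∂ν := by
        refine lintegral_mono fun z => ?_
        by_cases hz : z ∈ U
        · simpa [hz] using (hf01 z).2
        · have := hf0 hz
          simp [hz, this]
      _ = ν U := lintegral_indicator_one hU.measurableSet
  -- Finiteness of μ on compact sets is not assumed; it follows from the bound on compacts and
  -- supplies the inner regularity.
  have : IsFiniteMeasureOnCompacts μ := ⟨fun K hKc => (hK K hKc).trans_lt hKc.measure_lt_top⟩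
  have : IsLocallyFiniteMeasure μ := isLocallyFiniteMeasure_of_isFiniteMeasureOnCompacts
  refine Measure.le_iff.2 fun s hs => ?_
  rw [hs.measure_eq_iSup_isCompact μ]
  exact iSup₂_le fun K hKs => iSup_le fun hKc => (hK K hKc).trans (measure_mono hKs)

lemma join_le_of_laplace {lam : ℝ≥0} {Q : Measure (Measure ℂ)} [IsProbabilityMeasure Q]
    (hQ : ∀ h : ℂ → ℝ≥0, Continuous h → HasCompactSupport h →
      ∫⁻ φ, expNeg (∫⁻ z, h z ∂φ) ∂Q = poissonLaplace lam fun z => h z) :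
    Q.join ≤ lam • (volume : Measure ℂ) := by
  refine le_smul_of_lintegral_le fun f hf hc => ?_
  rw [lintegral_smul_measure]
  exact lintegral_join_le_of_laplace hQ hf hc

/-- One half of the L¹ stability used for approximation; `lintegral_expNeg_le_add` is its
counterpart under Q, where the intensity bound controls the mean of ∫d dφ. -/
lemma poissonLaplace_le_add {lam : ℝ≥0} {f g d : ℂ → ℝ≥0∞} (hg : Measurable g)
    (h : ∀ z, f z ≤ g z + d z) :
    poissonLaplace lam g ≤ poissonLaplace lam f + lam * ∫⁻ z, d z := by
  calc poissonLaplace lam g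
      ≤ expNeg ((lam * ∫⁻ z, (1 - expNeg (g z))) + lam * ∫⁻ z, d z) + lam * ∫⁻ z, d z :=
        expNeg_le_expNeg_add _ _
    _ ≤ _ := by
      refine add_le_add_left ?_ _
      rw [expNeg_add]
      exact (poissonLaplace_mul_le hg).trans (poissonLaplace_antitone h)

lemma lintegral_expNeg_le_add {lam : ℝ≥0} {Q : Measure (Measure ℂ)}
    (hQ : Q.join ≤ lam • (volume : Measure ℂ)) {f g d : ℂ → ℝ≥0∞} (hf : Measurable f)
    (hg : Measurable g) (hd : Measurable d) (h : ∀ z, f z ≤ g z + d z) :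
    ∫⁻ φ, expNeg (∫⁻ z, g z ∂φ) ∂Q ≤ ∫⁻ φ, expNeg (∫⁻ z, f z ∂φ) ∂Q + lam * ∫⁻ z, d z := by
  have hd' : ∫⁻ φ, ∫⁻ z, d z ∂φ ∂Q ≤ lam * ∫⁻ z, d z := by
    rw [← Measure.lintegral_join hd.aemeasurable]
    refine (lintegral_mono' hQ le_rfl).trans_eq ?_
    rw [lintegral_smul_measure]; rfl
  have hmf : Measurable fun φ : Measure ℂ => ∫⁻ z, f z ∂φ := Measure.measurable_lintegral hf
  refine le_trans ?_ (add_le_add_right hd' _)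
  rw [← lintegral_add_left (by fun_prop)]
  refine lintegral_mono fun φ => ?_
  refine (expNeg_le_expNeg_add _ (∫⁻ z, d z ∂φ)).trans ?_
  gcongr
  refine expNeg_antitone ?_
  rw [← lintegral_add_left hg]
  exact lintegral_mono h

/-- Both sides are Lipschitz in the L¹ norm, and continuous functions of compact support are dense
there. -/
lemma laplace_of_integrable {lam : ℝ≥0} {Q : Measure (Measure ℂ)} [IsProbabilityMeasure Q]
    (hQ : ∀ h : ℂ → ℝ≥0, Continuous h → HasCompactSupport h →
      ∫⁻ φ, expNeg (∫⁻ z, h z ∂φ) ∂Q = poissonLaplace lam fun z => h z)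
    {f : ℂ → ℝ} (hfm : Measurable f) (hf : Integrable f) :
    ∫⁻ φ, expNeg (∫⁻ z, ENNReal.ofReal (f z) ∂φ) ∂Q =
      poissonLaplace lam fun z => ENNReal.ofReal (f z) := by
  have hjoin := join_le_of_laplace hQ
  have key : ∀ ε : ℝ≥0∞, ε ≠ 0 → ∃ g : ℂ → ℝ≥0, ∃ d : ℂ → ℝ≥0∞, Continuous g ∧
      HasCompactSupport g ∧ Measurable d ∧ ∫⁻ z, d z ≤ ε ∧
      (∀ z, ENNReal.ofReal (f z) ≤ g z + d z) ∧ ∀ z, (g z : ℝ≥0∞) ≤ ENNReal.ofReal (f z) + d z := by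
    intro ε hε
    obtain ⟨g, hgc, hgε, hg, -⟩ := hf.exists_hasCompactSupport_lintegral_sub_le hε
    refine ⟨fun z => (g z).toNNReal, fun z => ‖f z - g z‖ₑ, by fun_prop,
      hgc.comp_left (g := Real.toNNReal) (by simp), by fun_prop, hgε, fun z => ?_, fun z => ?_⟩
    · simp only [Real.enorm_eq_ofReal_abs]
      rw [← ENNReal.ofReal.eq_1]
      refine le_trans ?_ ENNReal.ofReal_add_le
      exact ENNReal.ofReal_le_ofReal (by linarith [le_abs_self (f z - g z)])
    · simp only [Real.enorm_eq_ofReal_abs]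
      rw [← ENNReal.ofReal.eq_1]
      refine le_trans ?_ ENNReal.ofReal_add_le
      exact ENNReal.ofReal_le_ofReal (by linarith [neg_abs_le (f z - g z)])
  have hfm' : Measurable fun z => ENNReal.ofReal (f z) := by fun_prop
  -- Two errors of size λ∫d must add up to at most ε; the summand 1 keeps the denominator nonzero
  -- for every λ.
  have hε : ∀ ε : ℝ≥0, 0 < ε → ((ε : ℝ≥0∞) / (2 * (lam + 1))) ≠ 0 := fun ε hε => by
    simp only [ne_eq, ENNReal.div_eq_zero_iff, ENNReal.coe_eq_zero, hε.ne', false_or]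
    exact ENNReal.mul_ne_top (by simp) (by simp)
  have hε' : ∀ ε : ℝ≥0, ∀ x : ℝ≥0∞, x ≤ (ε : ℝ≥0∞) / (2 * (lam + 1)) →
      (lam : ℝ≥0∞) * x + lam * x ≤ ε := by
    intro ε x hx
    calc (lam : ℝ≥0∞) * x + lam * x = 2 * lam * x := by ring
      _ ≤ 2 * (lam + 1) * (ε / (2 * (lam + 1))) := by
        gcongr
        exact le_self_add
      _ ≤ ε := ENNReal.mul_div_le
  refine le_antisymm ?_ ?_
  · refine ENNReal.le_of_forall_pos_le_add fun ε hpos _ => ?_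
    obtain ⟨g, d, hg, hgc, hd, hdε, h1, h2⟩ := key _ (hε ε hpos)
    have hgm : Measurable fun z => (g z : ℝ≥0∞) := by fun_prop
    have a1 := lintegral_expNeg_le_add hjoin hgm hfm' hd h2
    rw [hQ g hg hgc] at a1
    refine a1.trans ((add_le_add_left (poissonLaplace_le_add hgm h1) _).trans ?_)
    rw [add_assoc]
    exact add_le_add_right (hε' ε _ hdε) _
  · refine ENNReal.le_of_forall_pos_le_add fun ε hpos _ => ?_
    obtain ⟨g, d, hg, hgc, hd, hdε, h1, h2⟩ := key _ (hε ε hpos)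
    have hgm : Measurable fun z => (g z : ℝ≥0∞) := by fun_prop
    have a1 := poissonLaplace_le_add (lam := lam) hfm' h2
    rw [← hQ g hg hgc] at a1
    refine a1.trans ((add_le_add_left (lintegral_expNeg_le_add hjoin hfm' hgm hd h1) _).trans ?_)
    rw [add_assoc]
    exact add_le_add_right (hε' ε _ hdε) _

/-- Given a point at `a`, the other points of a Poisson process have the Laplace functional of the
Poisson process. -/
lemma IsReducedPalm.laplace {Ω₀ : Type*} [MeasurableSpace Ω₀] {P₀ : Measure Ω₀}
    [IsFiniteMeasure P₀] {lam : ℝ≥0} (hlam : 0 < lam) {a : ℂ} {Z : ℕ → Ω₀ → ℂ}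
    (hZ : IsPoissonProcess lam Z P₀)
    {Ω : Type*} [MeasurableSpace Ω] {P : Measure Ω} [IsProbabilityMeasure P] {X : ℕ → Ω → ℂ}
    (hX : ∀ i, Measurable (X i))
    (hQ : IsReducedPalm lam a Z P₀ (P.map fun ω => config fun i => X i ω))
    {h : ℂ → ℝ≥0∞} (hh : Measurable h) :
    ∫⁻ ω, expNeg (∑' i, h (X i ω)) ∂P = poissonLaplace lam h := by
  have hXm : Measurable fun ω => config fun i => X i ω := measurable_config hX
  have : IsProbabilityMeasure (P.map fun ω => config fun i => X i ω) :=
    Measure.isProbabilityMeasure_map hXm.aemeasurable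
  have hint : ∀ f : ℂ → ℝ≥0∞, Measurable f → ∫⁻ φ, expNeg (∫⁻ z, f z ∂φ)
      ∂(P.map fun ω => config fun i => X i ω) = ∫⁻ ω, expNeg (∑' i, f (X i ω)) ∂P := by
    intro f hf
    have hm : Measurable fun φ : Measure ℂ => ∫⁻ z, f z ∂φ := Measure.measurable_lintegral hf
    rw [lintegral_map (by fun_prop) hXm]
    simp_rw [lintegral_config]
  have htop : ∀ (n : ℕ) z, min (h z) n ≠ ∞ := fun n z =>
    ((min_le_right _ _).trans_lt (ENNReal.natCast_lt_top n)).ne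
  -- Cutting off both the values and the support at n gives integrable functions that increase to h.
  set f : ℕ → ℂ → ℝ≥0∞ := fun n => (Metric.ball 0 n).indicator fun z => min (h z) n
  have hfm : ∀ n, Measurable (f n) := fun n =>
    (hh.min measurable_const).indicator Metric.isOpen_ball.measurableSet
  have hfle : ∀ n z, f n z ≤ n := fun n z => (Set.indicator_le_self _ _ z).trans (min_le_right _ _)
  have hftop : ∀ n z, f n z ≠ ∞ := fun n z => ((hfle n z).trans_lt (ENNReal.natCast_lt_top n)).ne
  refine laplace_of_approx hX (f := f) hfm (fun z m n hmn => ?_) (fun z => ?_) (fun n => ?_)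
  · refine (Set.indicator_le_indicator_of_subset (Metric.ball_subset_ball
      (by exact_mod_cast hmn : (m : ℝ) ≤ n)) (fun _ => zero_le) z).trans ?_
    refine Set.indicator_le_indicator ?_
    gcongr
  · have h1 : Tendsto (fun n : ℕ => min (h z) (n : ℝ≥0∞)) atTop (𝓝 (min (h z) ∞)) :=
      tendsto_const_nhds.min ENNReal.tendsto_nat_nhds_top
    rw [min_eq_left le_top] at h1
    refine h1.congr' ?_
    obtain ⟨N, hN⟩ := exists_nat_gt ‖z‖
    filter_upwards [eventually_ge_atTop N] with n hn
    change min (h z) n = (Metric.ball (0 : ℂ) n).indicator (fun z => min (h z) (n : ℝ≥0∞)) z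
    rw [Set.indicator_of_mem]
    rw [mem_ball_zero_iff]
    exact hN.trans_le (by exact_mod_cast hn)
  · rw [← hint _ (hfm n)]
    have hof : f n = fun z => ENNReal.ofReal (f n z).toReal := by
      ext z; rw [ENNReal.ofReal_toReal (hftop n z)]
    rw [hof]
    refine laplace_of_integrable
      (fun h hh hc => hQ.laplace_of_hasCompactSupport hlam hZ hh hc)
      (hfm n).ennreal_toReal ?_
    refine integrable_toReal_of_lintegral_ne_top (hfm n).aemeasurable ?_
    refine ne_of_lt (lt_of_le_of_lt (lintegral_mono (g := (Metric.ball (0 : ℂ) n).indicator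
      fun _ => (n : ℝ≥0∞)) fun z => ?_) ?_)
    · exact Set.indicator_le_indicator (min_le_right _ _)
    · rw [lintegral_indicator_const Metric.isOpen_ball.measurableSet]
      exact ENNReal.mul_lt_top (ENNReal.natCast_lt_top n) measure_ball_lt_top

/-! ### Independent markings -/

/-- The kernel of independent marks at the first `n` points of a sequence. -/
def piKernel {K : Type*} [MeasurableSpace K] (κ : Kernel ℂ K) [IsMarkovKernel κ] (n : ℕ) :
    Kernel (ℕ → ℂ) (Fin n → K) where
  toFun x := Measure.pi fun i : Fin n => κ (x i)
  measurable' := by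
    refine Measurable.measure_of_isPiSystem_of_isProbabilityMeasure generateFrom_pi.symm
      isPiSystem_pi ?_
    rintro _ ⟨B, hB, rfl⟩
    simp only [Measure.pi_pi]
    refine Finset.measurable_prod _ fun i _ => ?_
    exact (κ.measurable_coe (hB i (Set.mem_univ i))).comp (measurable_pi_apply _)

lemma piKernel_apply {K : Type*} [MeasurableSpace K] (κ : Kernel ℂ K) [IsMarkovKernel κ] (n : ℕ)
    (x : ℕ → ℂ) : piKernel κ n x = Measure.pi fun i : Fin n => κ (x i) := rfl

instance {K : Type*} [MeasurableSpace K] (κ : Kernel ℂ K) [IsMarkovKernel κ] (n : ℕ) :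
    IsMarkovKernel (piKernel κ n) :=
  ⟨fun x => by rw [piKernel_apply]; infer_instance⟩

section Marking

variable {Ω K : Type*} [MeasurableSpace Ω] [MeasurableSpace K] {P : Measure Ω}
  [IsProbabilityMeasure P] {X : ℕ → Ω → ℂ} {M : ℕ → Ω → K} {κ : Kernel ℂ K} [IsMarkovKernel κ]

/-- The rectangles A × ∏Bᵢ form a generating π-system, and on them the claim is the definition of an
independent marking. -/
lemma IsIndepMarking.map_eq_compProd (h : IsIndepMarking X M κ P) (hX : ∀ i, Measurable (X i))
    (hM : ∀ i, Measurable (M i)) (n : ℕ) :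
    P.map (fun ω => ((fun i => X i ω), fun i : Fin n => M i ω)) =
      (P.map fun ω i => X i ω) ⊗ₘ piKernel κ n := by
  have hXm : Measurable fun ω i => X i ω := measurable_pi_lambda _ hX
  have hMm : Measurable fun ω (i : Fin n) => M i ω := measurable_pi_lambda _ fun i => hM i
  have hPm : IsProbabilityMeasure (P.map fun ω i => X i ω) :=
    Measure.isProbabilityMeasure_map hXm.aemeasurable
  have hPm2 : IsProbabilityMeasure (P.map fun ω => ((fun i => X i ω), fun i : Fin n => M i ω)) :=
    Measure.isProbabilityMeasure_map (hXm.prodMk hMm).aemeasurable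
  refine ext_of_generate_finite _ (generateFrom_eq_prod (C := {s | MeasurableSet s})
    MeasurableSpace.generateFrom_measurableSet generateFrom_pi
    isCountablySpanning_measurableSet ?_).symm
    (MeasurableSpace.isPiSystem_measurableSet.prod isPiSystem_pi) ?_ (by simp)
  · exact ⟨fun _ => Set.univ, fun _ => ⟨fun _ => Set.univ, by simp, by simp⟩, Set.iUnion_const _⟩
  · rintro _ ⟨A, hA, _, ⟨B, hB, rfl⟩, rfl⟩
    have hB' : ∀ i, MeasurableSet (B i) := fun i => hB i (Set.mem_univ i)
    have hA' : MeasurableSet A := hA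
    -- The definition takes a set for every index in ℕ; those beyond n impose no condition.
    set B' : ℕ → Set K := fun i => if h : i < n then B ⟨i, h⟩ else Set.univ
    have hBB : ∀ i : Fin n, B' i = B i := fun i => by simp [B']
    have hBm : ∀ i, MeasurableSet (B' i) := fun i => by
      by_cases hi : i < n
      · simp [B', hi, hB']
      · simp [B', hi]
    rw [Measure.map_apply (hXm.prodMk hMm) (hA'.prod (MeasurableSet.univ_pi hB')),
      Measure.compProd_apply_prod hA' (MeasurableSet.univ_pi hB')]
    have hset : (fun ω => ((fun i => X i ω), fun i : Fin n => M i ω)) ⁻¹'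
        A ×ˢ Set.univ.pi B =
        {ω | (fun i => X i ω) ∈ A} ∩ {ω | ∀ i ∈ Finset.range n, M i ω ∈ B' i} := by
      ext ω
      simp only [Set.mem_preimage, Set.mem_prod, Set.mem_pi, Set.mem_univ, true_imp_iff,
        Set.mem_inter_iff, Set.mem_ofPred_eq, Finset.mem_range]
      refine and_congr_right fun _ => ⟨fun h i hi => ?_, fun h i => ?_⟩
      · have := h ⟨i, hi⟩
        rwa [← hBB] at this
      · rw [← hBB]; exact h i i.2
    rw [hset, h (Finset.range n) A hA' B' hBm,
      setLIntegral_map hA' ((piKernel κ n).measurable_coe (MeasurableSet.univ_pi hB')) hXm]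
    refine lintegral_congr fun ω => ?_
    rw [piKernel_apply, Measure.pi_pi, Finset.prod_range]
    simp_rw [hBB]

lemma IsIndepMarking.lintegral_prod (h : IsIndepMarking X M κ P) (hX : ∀ i, Measurable (X i))
    (hM : ∀ i, Measurable (M i)) {ψ : ℂ → K → ℝ≥0∞} (hψ : Measurable (Function.uncurry ψ)) (n : ℕ) :
    ∫⁻ ω, ∏ i ∈ Finset.range n, ψ (X i ω) (M i ω) ∂P =
      ∫⁻ ω, ∏ i ∈ Finset.range n, ∫⁻ m, ψ (X i ω) m ∂κ (X i ω) ∂P := by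
  have hXm : Measurable fun ω i => X i ω := measurable_pi_lambda _ hX
  have hMm : Measurable fun ω (i : Fin n) => M i ω := measurable_pi_lambda _ fun i => hM i
  have hF : Measurable fun p : (ℕ → ℂ) × (Fin n → K) => ∏ i : Fin n, ψ (p.1 i) (p.2 i) := by
    refine Finset.measurable_prod _ fun i _ => ?_
    exact hψ.comp (f := fun p : (ℕ → ℂ) × (Fin n → K) => (p.1 i, p.2 i)) (by fun_prop)
  have h1 : ∫⁻ ω, ∏ i ∈ Finset.range n, ψ (X i ω) (M i ω) ∂P =
      ∫⁻ p, ∏ i : Fin n, ψ (p.1 i) (p.2 i)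
        ∂(P.map fun ω => ((fun i => X i ω), fun i : Fin n => M i ω)) := by
    rw [lintegral_map hF (hXm.prodMk hMm)]
    simp_rw [Finset.prod_range]
  have hPm : IsProbabilityMeasure (P.map fun ω i => X i ω) :=
    Measure.isProbabilityMeasure_map hXm.aemeasurable
  rw [h1, h.map_eq_compProd hX hM, Measure.lintegral_compProd hF]
  have h2 : ∀ x : ℕ → ℂ, ∫⁻ m, ∏ i : Fin n, ψ (x i) (m i) ∂piKernel κ n x =
      ∏ i : Fin n, ∫⁻ m, ψ (x i) m ∂κ (x i) := by
    intro x
    rw [piKernel_apply]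
    have hψx : ∀ i : Fin n, Measurable (ψ (x i)) := fun i => hψ.of_uncurry_left
    have hind := iIndepFun_pi (μ := fun i : Fin n => κ (x i)) (X := fun i => ψ (x i))
      fun i => (hψx i).aemeasurable
    rw [lintegral_prod_eq_prod_lintegral_of_indepFun Finset.univ _ hind
      fun i => (hψx i).comp (measurable_pi_apply i)]
    refine Finset.prod_congr rfl fun i _ => ?_
    exact (measurePreserving_eval (fun i : Fin n => κ (x i)) i).lintegral_comp (hψx i)
  simp_rw [h2]
  rw [lintegral_map _ hXm]
  · simp_rw [Finset.prod_range]
  · refine Finset.measurable_prod _ fun i _ => ?_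
    exact (hψ.lintegral_kernel_prod_right (κ := κ)).comp (measurable_pi_apply _)

/-- The Laplace functional of an independent marking of a Poisson-like process. -/
lemma IsIndepMarking.laplace (h : IsIndepMarking X M κ P) (hX : ∀ i, Measurable (X i))
    (hM : ∀ i, Measurable (M i)) {lam : ℝ≥0}
    (hlap : ∀ f : ℂ → ℝ≥0∞, Measurable f →
      ∫⁻ ω, expNeg (∑' i, f (X i ω)) ∂P = poissonLaplace lam f)
    {g : ℂ → K → ℝ≥0∞} (hg : Measurable (Function.uncurry g)) :
    ∫⁻ ω, expNeg (∑' i, g (X i ω) (M i ω)) ∂P =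
      expNeg (lam * ∫⁻ x, ∫⁻ m, (1 - expNeg (g x m)) ∂κ x) := by
  -- f(x) is the mean of e^{-g} over the mark of a point at x. As f ≤ 1, it is e^{-negLog f}, so the
  -- marked functional becomes the unmarked one at `negLog (f x)`, possibly infinite.
  set f : ℂ → ℝ≥0∞ := fun x => ∫⁻ m, expNeg (g x m) ∂κ x
  have hge : Measurable (Function.uncurry fun x m => expNeg (g x m)) := measurable_expNeg.comp hg
  have hf : Measurable f := hge.lintegral_kernel_prod_right
  have hf1 : ∀ x, f x ≤ 1 := fun x =>
    (lintegral_mono fun m => expNeg_le_one (g x m)).trans (by simp)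
  have hgi : ∀ i, Measurable fun ω => g (X i ω) (M i ω) := fun i =>
    hg.comp ((hX i).prodMk (hM i))
  have hfi : ∀ i, Measurable fun ω => negLog (f (X i ω)) := fun i =>
    measurable_negLog.comp (hf.comp (hX i))
  -- Conditioning on locations is available for finitely many marks at a time; the full sum is
  -- reached by bounded convergence.
  have hlim : ∀ u : ℕ → Ω → ℝ≥0∞, (∀ i, Measurable (u i)) →
      Tendsto (fun n => ∫⁻ ω, expNeg (∑ i ∈ Finset.range n, u i ω) ∂P) atTop
        (𝓝 (∫⁻ ω, expNeg (∑' i, u i ω) ∂P)) := fun u hu =>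
    tendsto_lintegral_expNeg (fun n => Finset.measurable_sum _ fun i _ => hu i)
      fun ω => ENNReal.tendsto_nat_tsum _
  have heq : ∀ n, ∫⁻ ω, expNeg (∑ i ∈ Finset.range n, g (X i ω) (M i ω)) ∂P =
      ∫⁻ ω, expNeg (∑ i ∈ Finset.range n, negLog (f (X i ω))) ∂P := by
    intro n
    simp_rw [expNeg_sum, expNeg_negLog (hf1 _)]
    exact h.lintegral_prod hX hM hge n
  have h1 := hlim _ hgi
  simp_rw [heq] at h1
  rw [tendsto_nhds_unique h1 (hlim _ hfi), hlap (fun x => negLog (f x)) (by fun_prop),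
    poissonLaplace]
  congr 2
  refine lintegral_congr fun x => ?_
  have hgx : Measurable fun m => expNeg (g x m) := hge.of_uncurry_left
  rw [expNeg_negLog (hf1 x), lintegral_sub hgx]
  · simp [f]
  · exact ((hf1 x).trans_lt ENNReal.one_lt_top).ne
  · exact ae_of_all _ fun m => expNeg_le_one _

end Marking

/-! ### Exponential fading -/

instance : IsProbabilityMeasure (expMeasure 1) := isProbabilityMeasure_expMeasure one_pos

lemma expMeasure_eq_withDensity (r : ℝ) :
    expMeasure r = volume.withDensity (exponentialPDF r) := rfl

lemma measurable_exponentialPDF (r : ℝ) : Measurable (exponentialPDF r) :=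
  (measurable_exponentialPDFReal r).ennreal_ofReal

lemma expMeasure_Ioi (t : ℝ≥0) : expMeasure 1 (Set.Ioi (t : ℝ)) = expNeg t := by
  rw [← Set.compl_Iic, prob_compl_eq_one_sub measurableSet_Iic, ← ofReal_cdf,
    cdf_expMeasure_eq one_pos, if_pos t.coe_nonneg, expNeg_coe, one_mul,
    ← ENNReal.ofReal_one, ← ENNReal.ofReal_sub _ (by
      simp only [sub_nonneg, Real.exp_le_one_iff, Left.neg_nonpos_iff, NNReal.zero_le_coe])]
  simp

lemma expMeasure_Ici (t : ℝ≥0) : expMeasure 1 (Set.Ici (t : ℝ)) = expNeg t := by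
  rw [← expMeasure_Ioi]
  refine (measure_congr ?_).symm
  rw [expMeasure_eq_withDensity]
  exact (withDensity_absolutelyContinuous _ _).ae_eq Ioi_ae_eq_Ici

/-- The exponential tail. With a ≠ 0 the convention a/0 = ∞ is right for c = 0, where the event is
empty. -/
lemma expMeasure_lt_mul {a c : ℝ≥0∞} (ha : a ≠ 0) (hc : c ≠ ∞) :
    expMeasure 1 {F : ℝ | a < ENNReal.ofReal F * c} = expNeg (a / c) := by
  rcases eq_or_ne c 0 with rfl | hc0
  · simp [ENNReal.div_zero ha]
  have h : {F : ℝ | a < ENNReal.ofReal F * c} = {F : ℝ | a / c < ENNReal.ofReal F} := by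
    ext F
    exact (ENNReal.div_lt_iff (Or.inl hc0) (Or.inl hc)).symm
  rw [h]
  rcases eq_or_ne (a / c) ∞ with ht | ht
  · simp [ht]
  lift a / c to ℝ≥0 using ht with t
  rw [← expMeasure_Ioi]
  congr 1
  ext F
  rw [Set.mem_ofPred_eq, ENNReal.lt_ofReal_iff_toReal_lt (by simp)]
  simp

lemma expMeasure_mul_lt {a c : ℝ≥0∞} (ha : a ≠ 0) (hc : c ≠ ∞) :
    expMeasure 1 {F : ℝ | ENNReal.ofReal F * c < a} = 1 - expNeg (a / c) := by
  have hm : MeasurableSet {F : ℝ | a ≤ ENNReal.ofReal F * c} :=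
    measurableSet_le measurable_const (by fun_prop)
  have h0 : {F : ℝ | ENNReal.ofReal F * c < a} = {F : ℝ | a ≤ ENNReal.ofReal F * c}ᶜ := by
    ext F; simp
  rw [h0, prob_compl_eq_one_sub hm]
  congr 1
  rcases eq_or_ne c 0 with rfl | hc0
  · simp [ENNReal.div_zero ha, ha]
  have h : {F : ℝ | a ≤ ENNReal.ofReal F * c} = {F : ℝ | a / c ≤ ENNReal.ofReal F} := by
    ext F
    exact (ENNReal.div_le_iff hc0 hc).symm
  rw [h]
  -- A positive threshold is needed: `ENNReal.ofReal` sends negative F to 0, so at threshold 0 the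
  -- set would be all of ℝ, not a half-line.
  have hpos : a / c ≠ 0 := by simp [ENNReal.div_eq_zero_iff, ha, hc]
  rcases eq_or_ne (a / c) ∞ with ht | ht
  · simp [ht]
  lift a / c to ℝ≥0 using ht with t
  rw [← expMeasure_Ici]
  congr 1
  ext F
  have ht0 : t ≠ 0 := by simpa using hpos
  rw [Set.mem_ofPred_eq, Set.mem_Ici, ENNReal.ofReal, ENNReal.coe_le_coe,
    Real.le_toNNReal_iff_coe_le' (pos_iff_ne_zero.2 ht0)]

/-- Tilting the density by e^{-cx} gives (1+c)^{-1} times the density of rate 1+c. -/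
lemma lintegral_expNeg_expMeasure {c : ℝ≥0∞} (hc : c ≠ ∞) :
    ∫⁻ F, expNeg (c * ENNReal.ofReal F) ∂expMeasure 1 = 1 / (1 + c) := by
  lift c to ℝ≥0 using hc
  rw [expMeasure_eq_withDensity,
    lintegral_withDensity_eq_lintegral_mul _ (measurable_exponentialPDF 1) (by fun_prop)]
  have h : ∀ x : ℝ, (exponentialPDF 1 * fun F => expNeg (c * ENNReal.ofReal F)) x =
      (1 + c : ℝ≥0∞)⁻¹ * exponentialPDF (1 + c) x := by
    intro x
    have e1 : (1 + c : ℝ≥0∞)⁻¹ = ENNReal.ofReal ((1 + (c : ℝ))⁻¹) := by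
      rw [ENNReal.ofReal_inv_of_pos (by positivity), ENNReal.ofReal_add (by simp) c.coe_nonneg]
      simp
    simp only [Pi.mul_apply, exponentialPDF_eq]
    split_ifs with hx
    · have e2 : (c : ℝ≥0∞) * ENNReal.ofReal x = ENNReal.ofReal (c * x) := by
        rw [ENNReal.ofReal_mul c.coe_nonneg, ENNReal.ofReal_coe_nnreal]
      rw [e2, expNeg_ofReal (by positivity), e1, ← ENNReal.ofReal_mul (by positivity),
        ← ENNReal.ofReal_mul (by positivity)]
      congr 1
      rw [one_mul, one_mul, ← Real.exp_add]
      have : (1 + (c : ℝ)) ≠ 0 := by positivity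
      field_simp
      ring_nf
    · simp
  rw [lintegral_congr h, lintegral_const_mul _ (measurable_exponentialPDF _),
    lintegral_exponentialPDF_eq_one (by positivity), mul_one, one_div]

/-! ### Orientations and blockage states -/

instance : IsProbabilityMeasure uniformAngle := by
  constructor
  have : (0 : ℝ) < 2 * Real.pi := by positivity
  rw [uniformAngle, Measure.smul_apply, Measure.restrict_apply MeasurableSet.univ, Set.univ_inter,
    Real.volume_Ioc, sub_zero, smul_eq_mul]
  exact ENNReal.inv_mul_cancel (by simpa using this) ENNReal.ofReal_ne_top

namespace Params

variable (S : Params)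

lemma pr_le_one (T : Bool) {z : ℝ} (hz : 0 ≤ z) : S.pr T z ≤ 1 := by
  cases T
  · simp [pr]
  · simp only [pr, if_true, ENNReal.ofReal_le_one, Real.exp_le_one_iff, Left.neg_nonpos_iff]
    positivity

lemma pr_add {z : ℝ} (hz : 0 ≤ z) : S.pr true z + S.pr false z = 1 := by
  have := S.pr_le_one true hz
  simp only [pr, if_true] at this ⊢
  simpa using add_tsub_cancel_of_le this

lemma pr_ne_top (T : Bool) (z : ℝ) : S.pr T z ≠ ∞ := by
  cases T <;> simp [pr]

lemma isProbabilityMeasure_stateLaw {z : ℝ} (hz : 0 ≤ z) :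
    IsProbabilityMeasure (S.stateLaw z) := ⟨by simp [stateLaw, S.pr_add hz]⟩

instance (z : ℝ) : IsFiniteMeasure (S.stateLaw z) := by
  refine ⟨?_⟩
  have := S.pr_ne_top true z
  have := S.pr_ne_top false z
  simp [stateLaw, lt_top_iff_ne_top, *]

lemma lintegral_stateLaw (z : ℝ) (f : Bool → ℝ≥0∞) :
    ∫⁻ T, f T ∂S.stateLaw z = ∑ T, S.pr T z * f T := by
  simp [stateLaw, lintegral_add_measure, lintegral_smul_measure]

lemma one_sub_sum_pr {z : ℝ} (hz : 0 ≤ z) {e : Bool → ℝ≥0∞} (he : ∀ T, e T ≤ 1) :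
    1 - ∑ T, S.pr T z * e T = ∑ T, S.pr T z * (1 - e T) := by
  have h1 : ∑ T, S.pr T z * (1 - e T) + ∑ T, S.pr T z * e T = 1 := by
    rw [← Finset.sum_add_distrib]
    simp_rw [← mul_add, tsub_add_cancel_of_le (he _)]
    simpa using S.pr_add hz
  refine (ENNReal.eq_sub_of_add_eq ?_ h1).symm
  exact ENNReal.sum_ne_top.2 fun T _ => ENNReal.mul_ne_top (S.pr_ne_top T z)
    ((he T).trans_lt ENNReal.one_lt_top).ne

@[fun_prop]
lemma measurable_pr (T : Bool) : Measurable (S.pr T) := by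
  unfold pr
  cases T <;> simp <;> fun_prop

lemma measurable_stateLaw : Measurable S.stateLaw := by
  refine Measure.measurable_of_measurable_coe _ fun s hs => ?_
  simp only [stateLaw, Measure.add_apply, Measure.smul_apply, smul_eq_mul]
  fun_prop

/-- The blockage state as a kernel from path lengths. -/
def stateKernel (p : ℂ) : Kernel ℂ Bool :=
  ⟨fun x => S.stateLaw ‖x - p‖, S.measurable_stateLaw.comp (by fun_prop)⟩

instance (p : ℂ) : IsMarkovKernel (S.stateKernel p) :=
  ⟨fun _ => S.isProbabilityMeasure_stateLaw (norm_nonneg _)⟩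

/-- `markLaw` as a kernel. -/
def markKernel : Kernel ℂ (ℝ × Bool × Bool × ℝ × ℝ) :=
  Kernel.const ℂ uniformAngle ×ₖ (S.stateKernel S.Yp ×ₖ (S.stateKernel 0 ×ₖ
    Kernel.const ℂ ((expMeasure 1).prod (expMeasure 1))))

instance : IsMarkovKernel S.markKernel := by unfold markKernel; infer_instance

lemma markKernel_apply (x : ℂ) : S.markKernel x = S.markLaw x := by
  rw [markKernel, Kernel.prod_apply, Kernel.prod_apply, Kernel.prod_apply, Kernel.const_apply,
    Kernel.const_apply, markLaw]
  simp [stateKernel]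

/-! ### Measurability of the received powers -/

@[fun_prop]
lemma measurable_pathLoss (T : Bool) : Measurable (S.pathLoss T) := by
  unfold pathLoss; fun_prop

@[fun_prop]
lemma _root_.SLS.Bearing.measurable_angle (b : Bearing) (Y : ℂ) : Measurable (b.angle Y) := by
  cases b
  · exact Complex.measurable_arg.comp (by fun_prop)
  · exact Complex.measurable_arg.comp (by fun_prop)

lemma measurable_of_forall_bool {α β : Type*} [MeasurableSpace α] [MeasurableSpace β]
    {f : α → Bool → β} (hf : ∀ T, Measurable fun a => f a T) {u : α → Bool} (hu : Measurable u) :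
    Measurable fun a => f a (u a) :=
  (measurable_from_prod_countable_left (f := fun p : α × Bool => f p.1 p.2) hf).comp
    (measurable_id.prodMk hu)

lemma measurable_pathLoss_comp {α : Type*} [MeasurableSpace α] {T : α → Bool} {z : α → ℝ}
    (hT : Measurable T) (hz : Measurable z) : Measurable fun a => S.pathLoss (T a) (z a) :=
  measurable_of_forall_bool (f := fun a T => S.pathLoss T (z a))
    (fun T => (S.measurable_pathLoss T).comp hz) hT

variable {S}

lemma Admissible.measurable_active (hS : S.Admissible) (b : Bearing) {α : Type*}
    [MeasurableSpace α] {x : α → ℂ} {w G : α → ℝ} {T : α → Bool} (hx : Measurable x)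
    (hw : Measurable w) (hG : Measurable G) (hT : Measurable T) :
    Measurable fun a => S.active b (x a) (w a) (G a) (T a) := by
  have h1 := hS.gst_beam.measurable
  have h2 := hS.gpr_beam.measurable
  unfold active
  refine Measurable.ite (measurableSet_lt ?_ measurable_const) measurable_const measurable_const
  unfold powerAtPrimary
  have h3 := S.measurable_pathLoss_comp hT (z := fun a => ‖x a - S.Yp‖) (by fun_prop)
  fun_prop

end Params

/-! ### Polar coordinates -/

lemma norm_polar {r : ℝ} (hr : 0 < r) (θ : ℝ) : ‖polar r θ‖ = r := by
  rw [polar, norm_mul, Complex.norm_exp_ofReal_mul_I, mul_one, Complex.norm_real, Real.norm_eq_abs,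
    abs_of_pos hr]

lemma measurable_polar : Measurable fun p : ℝ × ℝ => polar p.1 p.2 := by
  unfold polar; fun_prop

lemma polar_add_two_pi (r θ : ℝ) : polar r (θ + 2 * Real.pi) = polar r θ := by
  unfold polar
  push_cast
  rw [add_mul, Complex.exp_periodic]

lemma exists_arg_polar {r : ℝ} (hr : 0 < r) (θ : ℝ) :
    ∃ n : ℤ, (polar r θ).arg = θ + n * (2 * Real.pi) := by
  have h1 := Complex.norm_mul_exp_arg_mul_I (polar r θ)
  rw [norm_polar hr, polar] at h1
  have h2 := mul_left_cancel₀ (Complex.ofReal_ne_zero.2 hr.ne') h1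
  obtain ⟨n, hn⟩ := Complex.exp_eq_exp_iff_exists_int.1 h2
  refine ⟨n, ?_⟩
  have h3 : ((((polar r θ).arg : ℝ) : ℂ)) * Complex.I =
      ((θ + n * (2 * Real.pi) : ℝ) : ℂ) * Complex.I := by
    rw [polar, hn]; push_cast; ring
  exact_mod_cast mul_right_cancel₀ Complex.I_ne_zero h3

/-- Periodicity lets the polar angle in (0, 2π] replace the principal argument used in the model. -/
lemma IsBeamPattern.arg_polar_sub {g : ℝ → ℝ≥0} (hg : IsBeamPattern g) {r : ℝ} (hr : 0 < r)
    (θ c : ℝ) : g ((polar r θ).arg - c) = g (θ - c) := by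
  obtain ⟨n, hn⟩ := exists_arg_polar hr θ
  rw [hn, add_sub_right_comm]
  exact hg.periodic.int_mul n _

lemma setLIntegral_Ioc_of_periodic {f : ℝ → ℝ≥0∞} {T : ℝ} (hT : 0 < T)
    (hf : Function.Periodic f T) (s t : ℝ) :
    ∫⁻ x in Set.Ioc s (s + T), f x = ∫⁻ x in Set.Ioc t (t + T), f x := by
  refine (isAddFundamentalDomain_Ioc hT s).setLIntegral_eq (isAddFundamentalDomain_Ioc hT t) f ?_
  rintro ⟨_, n, rfl⟩ x
  change f (n • T + x) = f x
  rw [add_comm]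
  exact hf.zsmul n x

lemma lintegral_polar {D : ℂ → ℝ≥0∞} (hD : Measurable D) :
    ∫⁻ z, D z = ∫⁻ θ in Set.Ioc 0 (2 * Real.pi), ∫⁻ r in Set.Ioi (0 : ℝ),
      D (polar r θ) * ENNReal.ofReal r := by
  have h1 : ∀ p : ℝ × ℝ, ENNReal.ofReal p.1 • D (Complex.polarCoord.symm p) =
      D (polar p.1 p.2) * ENNReal.ofReal p.1 := by
    intro p
    rw [smul_eq_mul, mul_comm, Complex.polarCoord_symm_apply, polar, Complex.exp_mul_I]
    push_cast
    rfl
  have hm : Measurable fun p : ℝ × ℝ => D (polar p.1 p.2) * ENNReal.ofReal p.1 :=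
    (hD.comp measurable_polar).mul (by fun_prop)
  rw [← Complex.lintegral_comp_polarCoord_symm, polarCoord_target]
  simp_rw [h1]
  rw [Measure.volume_eq_prod, ← Measure.prod_restrict, lintegral_prod_symm' _ hm,
    restrict_Ioo_eq_restrict_Ioc]
  -- The polar change of variables has angles in (-π, π]; periodicity moves the interval to (0, 2π].
  have hper : Function.Periodic
      (fun θ => ∫⁻ r in Set.Ioi (0 : ℝ), D (polar r θ) * ENNReal.ofReal r) (2 * Real.pi) := by
    intro θ
    simp only [polar_add_two_pi]
  have := setLIntegral_Ioc_of_periodic (by positivity) hper (-Real.pi) 0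
  rw [zero_add, show -Real.pi + 2 * Real.pi = Real.pi by ring] at this
  exact this

/-- A ray meets p at no more than one radius, a null set. For p the primary receiver this discards
the point where the path loss may be infinite. -/
lemma setLIntegral_polar_congr {f : ℝ → ℝ≥0∞} {g : ℝ → ℝ≥0∞} (p : ℂ) (θ : ℝ)
    (h : ∀ r, 0 < r → polar r θ ≠ p → f r = g r) :
    ∫⁻ r in Set.Ioi (0 : ℝ), f r = ∫⁻ r in Set.Ioi (0 : ℝ), g r := by
  refine lintegral_congr_ae ?_
  have h1 : ∀ᵐ r ∂(volume.restrict (Set.Ioi (0 : ℝ))), r ≠ ‖p‖ :=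
    ae_restrict_of_ae (by simp [ae_iff])
  filter_upwards [ae_restrict_mem measurableSet_Ioi, h1] with r hr hr'
  refine h r hr fun hp => hr' ?_
  rw [← hp, norm_polar hr]

/-! ### Arithmetic in `[0, ∞]` -/

lemma div_mul_rpow_neg {r : ℝ} (hr : 0 < r) (a k : ℝ≥0∞) (α : ℝ) :
    a / (k * ENNReal.ofReal r ^ (-α)) = a / k * ENNReal.ofReal r ^ α := by
  have h0 : ENNReal.ofReal r ^ α ≠ 0 := by simp [hr, ENNReal.rpow_eq_zero_iff]
  have ht : ENNReal.ofReal r ^ α ≠ ∞ := by simp [hr, ENNReal.rpow_eq_top_iff]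
  rw [ENNReal.rpow_neg, div_eq_mul_inv, ENNReal.mul_inv (by simp [h0]) (by simp [ht]), inv_inv,
    ← mul_assoc, ← div_eq_mul_inv]

/-- Brings the Laplace transform of the fading into the form with `Cs`, which is built from s⁻¹; s =
0 is covered through 1/∞ = 0. -/
lemma one_sub_one_div_one_add {s : ℝ≥0∞} (hs : s ≠ ∞) : 1 - 1 / (1 + s) = 1 / (1 + s⁻¹) := by
  rcases eq_or_ne s 0 with rfl | h0
  · simp
  have h1 : 1 / (1 + s⁻¹) = s / (1 + s) := by
    rw [← ENNReal.mul_div_mul_left 1 (1 + s⁻¹) h0 hs, mul_add, ENNReal.mul_inv_cancel h0 hs, mul_one,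
      add_comm]
  rw [h1]
  refine (ENNReal.eq_sub_of_add_eq (by simp) ?_).symm
  rw [← ENNReal.add_div, add_comm s 1]
  exact ENNReal.div_self (by simp) (by simp [hs])

namespace Params

variable {S : Params}

lemma pathLoss_ne_top (T : Bool) {z : ℝ} (hz : 0 < z) : S.pathLoss T z ≠ ∞ := by
  unfold pathLoss
  refine ENNReal.mul_ne_top (by simp) ?_
  simp [hz, ENNReal.rpow_eq_top_iff]

lemma active_eq_indicator (b : Bearing) (x : ℂ) (w G : ℝ) (T : Bool) :
    S.active b x w G T = {G : ℝ | ENNReal.ofReal G * (S.ps * S.gpr (S.omegap - b.angle S.Yp x) *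
      S.gst (b.angle S.Yp x - w) * S.pathLoss T ‖x - S.Yp‖) < S.rho}.indicator 1 G := by
  rw [active, powerAtPrimary, Set.indicator_apply]
  have : (S.ps : ℝ≥0∞) * ENNReal.ofReal G * S.gpr (S.omegap - b.angle S.Yp x) *
      S.gst (b.angle S.Yp x - w) * S.pathLoss T ‖x - S.Yp‖ = ENNReal.ofReal G *
      (S.ps * S.gpr (S.omegap - b.angle S.Yp x) *
      S.gst (b.angle S.Yp x - w) * S.pathLoss T ‖x - S.Yp‖) := by ring
  rw [this]
  rfl

lemma active_eq_zero_or_one (b : Bearing) (x : ℂ) (w G : ℝ) (T : Bool) :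
    S.active b x w G T = 0 ∨ S.active b x w G T = 1 := by
  unfold active; split_ifs <;> simp

/-- Probability of being active. -/
lemma Admissible.lintegral_active (hS : S.Admissible) (b : Bearing) {x : ℂ} (hx : x ≠ S.Yp)
    (w : ℝ) (T : Bool) :
    ∫⁻ G, S.active b x w G T ∂expMeasure 1 =
      1 - expNeg (S.rho / (S.ps * S.gpr (S.omegap - b.angle S.Yp x) *
        S.gst (b.angle S.Yp x - w) * S.pathLoss T ‖x - S.Yp‖)) := by
  simp_rw [active_eq_indicator]
  rw [lintegral_indicator_one (measurableSet_lt (by fun_prop) measurable_const), expMeasure_mul_lt]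
  · simpa using hS.rho_pos.ne'
  · refine ENNReal.mul_ne_top (ENNReal.mul_ne_top (ENNReal.mul_ne_top ?_ ?_) ?_)
      (pathLoss_ne_top T (norm_pos_iff.2 (sub_ne_zero.2 hx))) <;> simp

/-- The activity indicator U is 0 or 1, so 1 - e^{-sUF} = U(1 - e^{-sF}), and the two independent
fadings separate. -/
lemma Admissible.lintegral_fading (hS : S.Admissible) (b : Bearing) {x : ℂ} (hx : x ≠ S.Yp)
    (w : ℝ) (T : Bool) {s : ℝ≥0∞} (hs : s ≠ ∞) :
    ∫⁻ p, (1 - expNeg (s * S.active b x w p.1 T * ENNReal.ofReal p.2))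
        ∂(expMeasure 1).prod (expMeasure 1) =
      (1 - expNeg (S.rho / (S.ps * S.gpr (S.omegap - b.angle S.Yp x) *
        S.gst (b.angle S.Yp x - w) * S.pathLoss T ‖x - S.Yp‖))) * (1 / (1 + s⁻¹)) := by
  have h1 : ∀ p : ℝ × ℝ, 1 - expNeg (s * S.active b x w p.1 T * ENNReal.ofReal p.2) =
      S.active b x w p.1 T * (1 - expNeg (s * ENNReal.ofReal p.2)) := by
    intro p
    rcases S.active_eq_zero_or_one b x w p.1 T with h | h <;> simp [h]
  simp_rw [h1]
  have hm : Measurable fun G => S.active b x w G T :=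
    hS.measurable_active b measurable_const measurable_const measurable_id measurable_const
  rw [lintegral_prod_mul (g := fun F => 1 - expNeg (s * ENNReal.ofReal F)) hm.aemeasurable
    (by fun_prop), hS.lintegral_active b hx,
    lintegral_sub (by fun_prop), lintegral_expNeg_expMeasure hs]
  · simp [← one_sub_one_div_one_add hs]
  · exact ((lintegral_mono fun ω => expNeg_le_one _).trans_lt (by simp)).ne
  · exact ae_of_all _ fun ω => expNeg_le_one _

/-- Interference of a secondary transmitter at `x` with marks `m`. -/
def interference (S : Params) (b : Bearing) (x : ℂ) (m : ℝ × Bool × Bool × ℝ × ℝ) : ℝ≥0∞ :=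
  S.ps * (S.gsr (Complex.arg x) * S.gst (Complex.arg x - Real.pi - m.1)) *
    S.active b x m.1 m.2.2.2.1 m.2.1 * ENNReal.ofReal m.2.2.2.2 * S.pathLoss m.2.2.1 ‖x‖

lemma Admissible.measurable_interference (hS : S.Admissible) (b : Bearing) :
    Measurable (Function.uncurry (S.interference b)) := by
  have h1 := hS.gst_beam.measurable
  have h2 := hS.gsr_beam.measurable
  have h3 := Complex.measurable_arg
  have h4 : Measurable fun p : ℂ × ℝ × Bool × Bool × ℝ × ℝ =>
      S.active b p.1 p.2.1 p.2.2.2.2.1 p.2.2.1 :=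
    hS.measurable_active b (by fun_prop) (by fun_prop) (by fun_prop) (by fun_prop)
  have h5 : Measurable fun p : ℂ × ℝ × Bool × Bool × ℝ × ℝ => S.pathLoss p.2.2.2.1 ‖p.1‖ :=
    S.measurable_pathLoss_comp (by fun_prop) (by fun_prop)
  unfold interference Function.uncurry
  fun_prop

lemma Admissible.A0_ne_top (hS : S.Admissible) (T : Bool) : S.A0 T ≠ ∞ := by
  have := pathLoss_ne_top (S := S) T hS.rs_pos
  unfold pathLoss at this
  rw [A0, mul_assoc]
  exact ENNReal.mul_ne_top (by simp [ENNReal.mul_eq_top]) this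

/-- The marks are integrated by Fubini. For fixed orientation and state, the exponent is s·U·F, with
s free of fading, and s⁻¹ is exactly `Cs` times the power of the distance. -/
lemma Admissible.lintegral_interference (hS : S.Admissible) (b : Bearing) (τ : ℝ≥0)
    {T : Bool} (hA : S.A0 T ≠ 0) {r θ : ℝ} (hr : 0 < r) (hp : polar r θ ≠ S.Yp) :
    ∫⁻ m, (1 - expNeg (τ * S.interference b (polar r θ) m / S.A0 T)) ∂S.markLaw (polar r θ) =
      ∑ T₃ : Bool, S.pr T₃ r *
        ∫⁻ w, (1 - ∑ T₄ : Bool, S.pr T₄ (S.z0 r θ) *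
          expNeg (S.As0 b T₄ w r θ * ENNReal.ofReal (S.z0 r θ) ^ S.alpha T₄)) /
            (1 + S.Cs τ T T₃ w θ * ENNReal.ofReal r ^ S.alpha T₃) ∂uniformAngle := by
  have hAt := hS.A0_ne_top T
  have hgst := hS.gst_beam.measurable
  set x := polar r θ with hx
  have hxn : ‖x‖ = r := norm_polar hr θ
  set s : ℝ → Bool → ℝ≥0∞ := fun w T₃ => τ * (S.ps * (S.gsr (Complex.arg x) *
    S.gst (Complex.arg x - Real.pi - w)) * S.pathLoss T₃ ‖x‖) / S.A0 T with hs
  have hst : ∀ w T₃, s w T₃ ≠ ∞ := fun w T₃ => by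
    refine ENNReal.div_ne_top (ENNReal.mul_ne_top (by simp) (ENNReal.mul_ne_top
      (by simp [ENNReal.mul_eq_top]) ?_)) hA
    rw [hxn]
    exact pathLoss_ne_top T₃ hr
  have hsinv : ∀ w T₃, (s w T₃)⁻¹ = S.Cs τ T T₃ w θ * ENNReal.ofReal r ^ S.alpha T₃ := by
    intro w T₃
    have e1 := hS.gsr_beam.arg_polar_sub hr θ 0
    have e2 := hS.gst_beam.arg_polar_sub hr θ (Real.pi + w)
    rw [sub_zero, sub_zero] at e1
    rw [← sub_sub, show θ - (Real.pi + w) = θ - w - Real.pi by ring] at e2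
    simp only [hs, hx, e1, e2]
    rw [← hx, hxn, ENNReal.inv_div (Or.inl hAt) (Or.inl hA), Cs, ← div_mul_rpow_neg hr, pathLoss]
    congr 1
    ring
  have hz0 : 0 < S.z0 r θ := norm_pos_iff.2 (sub_ne_zero.2 hp)
  have hAs : ∀ w T₄, S.rho / (S.ps * S.gpr (S.omegap - b.angle S.Yp x) *
        S.gst (b.angle S.Yp x - w) * S.pathLoss T₄ ‖x - S.Yp‖) =
      S.As0 b T₄ w r θ * ENNReal.ofReal (S.z0 r θ) ^ S.alpha T₄ := by
    intro w T₄
    rw [As0, ← div_mul_rpow_neg hz0, pathLoss]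
    congr 1
    simp only [beta0, z0, ← hx]
    ring
  have hint : ∀ m : ℝ × Bool × Bool × ℝ × ℝ, τ * S.interference b x m / S.A0 T =
      s m.1 m.2.2.1 * S.active b x m.1 m.2.2.2.1 m.2.1 * ENNReal.ofReal m.2.2.2.2 := by
    intro m
    simp only [interference, hs, div_eq_mul_inv]
    ring
  have hm0 : Measurable fun m : ℝ × Bool × Bool × ℝ × ℝ =>
      1 - expNeg (τ * S.interference b x m / S.A0 T) := by
    have : Measurable (S.interference b x) := (hS.measurable_interference b).of_uncurry_left
    fun_prop
  simp_rw [hint] at hm0 ⊢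
  rw [markLaw, lintegral_prod _ hm0.aemeasurable]
  have hinner : ∀ w, ∫⁻ q, (1 - expNeg (s w q.2.1 * S.active b x w q.2.2.1 q.1 *
      ENNReal.ofReal q.2.2.2)) ∂((S.stateLaw ‖x - S.Yp‖).prod ((S.stateLaw ‖x‖).prod
        ((expMeasure 1).prod (expMeasure 1)))) =
      ∑ T₃ : Bool, S.pr T₃ r * ((1 - ∑ T₄ : Bool, S.pr T₄ (S.z0 r θ) *
          expNeg (S.As0 b T₄ w r θ * ENNReal.ofReal (S.z0 r θ) ^ S.alpha T₄)) /
            (1 + S.Cs τ T T₃ w θ * ENNReal.ofReal r ^ S.alpha T₃)) := by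
    intro w
    have hm1 := hm0.comp (measurable_prodMk_left (x := w))
    simp only [Function.comp_def] at hm1
    rw [lintegral_prod _ hm1.aemeasurable, lintegral_stateLaw]
    have h2 : ∀ T₄, ∫⁻ q, (1 - expNeg (s w q.1 * S.active b x w q.2.1 T₄ *
        ENNReal.ofReal q.2.2)) ∂((S.stateLaw ‖x‖).prod ((expMeasure 1).prod (expMeasure 1))) =
        ∑ T₃ : Bool, S.pr T₃ r * ((1 - expNeg (S.As0 b T₄ w r θ *
          ENNReal.ofReal (S.z0 r θ) ^ S.alpha T₄)) *
            (1 / (1 + S.Cs τ T T₃ w θ * ENNReal.ofReal r ^ S.alpha T₃))) := by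
      intro T₄
      have hm2 := hm1.comp (measurable_prodMk_left (x := T₄))
      simp only [Function.comp_def] at hm2
      rw [lintegral_prod _ hm2.aemeasurable, lintegral_stateLaw, hxn]
      refine Finset.sum_congr rfl fun T₃ _ => ?_
      rw [hS.lintegral_fading b hp w T₄ (hst w T₃), hAs, hsinv]
    simp_rw [h2]
    rw [S.one_sub_sum_pr hz0.le fun T₄ => expNeg_le_one _]
    simp only [Fintype.sum_bool, div_eq_mul_inv, one_mul]
    change S.pr true (S.z0 r θ) * _ + S.pr false (S.z0 r θ) * _ = _
    ring
  simp_rw [hinner]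
  have hAsm : ∀ T₄, Measurable fun w => S.As0 b T₄ w r θ := fun T₄ => by unfold As0; fun_prop
  have hCsm : ∀ T₃, Measurable fun w => S.Cs τ T T₃ w θ := fun T₃ => by unfold Cs; fun_prop
  have hfm : ∀ T₃, Measurable fun w => (1 - ∑ T₄ : Bool, S.pr T₄ (S.z0 r θ) *
      expNeg (S.As0 b T₄ w r θ * ENNReal.ofReal (S.z0 r θ) ^ S.alpha T₄)) /
        (1 + S.Cs τ T T₃ w θ * ENNReal.ofReal r ^ S.alpha T₃) := fun T₃ => by
    have := hAsm
    have := hCsm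
    fun_prop
  rw [lintegral_finsetSum _ fun T₃ _ => (hfm T₃).const_mul _]
  refine Finset.sum_congr rfl fun T₃ _ => ?_
  rw [lintegral_const_mul _ (hfm T₃)]

end Params

/-! ### The considered link -/

namespace Params

variable {S : Params}

/-- SINR in terms of the own variables `o` of the considered link and the interference `v` of the
other secondary transmitters. -/
def ownSinr (S : Params) (b : Bearing) (o : Bool × Bool × Bool × ℝ × ℝ × ℝ) (v : ℝ≥0∞) : ℝ≥0∞ :=
  ENNReal.ofReal o.2.2.2.1 * S.active b S.Xs Real.pi o.2.2.2.2.1 o.2.1 * S.ps * S.gst 0 * S.gsr 0 *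
      S.pathLoss o.1 S.rs /
    (S.sig2 + S.pp * (S.gsr S.deltap * S.gpt (S.deltap - Real.pi - S.omegap)) *
      ENNReal.ofReal o.2.2.2.2.2 * S.pathLoss o.2.2.1 S.xp + v)

lemma Admissible.measurable_ownSinr (hS : S.Admissible) (b : Bearing) :
    Measurable fun p : (Bool × Bool × Bool × ℝ × ℝ × ℝ) × ℝ≥0∞ => S.ownSinr b p.1 p.2 := by
  have h1 : Measurable fun p : (Bool × Bool × Bool × ℝ × ℝ × ℝ) × ℝ≥0∞ =>
      S.active b S.Xs Real.pi p.1.2.2.2.2.1 p.1.2.1 :=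
    hS.measurable_active b (by fun_prop) (by fun_prop) (by fun_prop) (by fun_prop)
  have h2 : Measurable fun p : (Bool × Bool × Bool × ℝ × ℝ × ℝ) × ℝ≥0∞ =>
      S.pathLoss p.1.1 S.rs := S.measurable_pathLoss_comp (by fun_prop) (by fun_prop)
  have h3 : Measurable fun p : (Bool × Bool × Bool × ℝ × ℝ × ℝ) × ℝ≥0∞ =>
      S.pathLoss p.1.2.2.1 S.xp := S.measurable_pathLoss_comp (by fun_prop) (by fun_prop)
  unfold ownSinr
  fun_prop

lemma Admissible.measurableSet_lt_ownSinr (hS : S.Admissible) (b : Bearing) (τ : ℝ≥0∞)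
    (v : ℝ≥0∞) : MeasurableSet {o | τ < S.ownSinr b o v} := by
  have h : Measurable fun o => S.ownSinr b o v :=
    (hS.measurable_ownSinr b).comp (f := fun o => (o, v)) (by fun_prop)
  exact measurableSet_lt measurable_const h

lemma indicator_lt_ownSinr (S : Params) (b : Bearing) {τ : ℝ≥0} (hτ : 0 < τ) (v : ℝ≥0∞)
    (T T₁ T₂ : Bool) (F G G' : ℝ) :
    {o | (τ : ℝ≥0∞) < S.ownSinr b o v}.indicator (1 : Bool × Bool × Bool × ℝ × ℝ × ℝ → ℝ≥0∞) (T, T₁, T₂, F, G, G') =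
      S.active b S.Xs Real.pi G T₁ * {F : ℝ | τ * (S.sig2 + S.A20 T₂ * ENNReal.ofReal G' + v) <
        ENNReal.ofReal F * S.A0 T}.indicator 1 F := by
  have h1 : (τ : ℝ≥0∞) < S.ownSinr b (T, T₁, T₂, F, G, G') v ↔
      τ * (S.sig2 + S.A20 T₂ * ENNReal.ofReal G' + v) <
        ENNReal.ofReal F * S.A0 T * S.active b S.Xs Real.pi G T₁ := by
    rw [ownSinr, ENNReal.lt_div_iff_mul_lt (by simp) (by simp [hτ.ne'])]
    simp only [A0, A20, pathLoss]
    ring_nf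
  simp only [Set.indicator_apply, Set.mem_ofPred_eq, h1]
  -- For an inactive transmitter the right side of `h1` is 0 and the strict inequality fails.
  rcases S.active_eq_zero_or_one b S.Xs Real.pi G T₁ with h | h <;> simp [h]

/-- The coverage probability given the blockage states and the secondary interference `v`. -/
lemma Admissible.lintegral_own_fading (hS : S.Admissible) (b : Bearing) {τ : ℝ≥0} (hτ : 0 < τ)
    (v : ℝ≥0∞) (T T₁ T₂ : Bool) :
    ∫⁻ q, {o | (τ : ℝ≥0∞) < S.ownSinr b o v}.indicator (1 : Bool × Bool × Bool × ℝ × ℝ × ℝ → ℝ≥0∞) (T, T₁, T₂, q)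
        ∂(expMeasure 1).prod ((expMeasure 1).prod (expMeasure 1)) =
      expNeg (τ * S.sig2 / S.A0 T) * (1 - expNeg (1 / S.A10 b T₁)) *
        (1 / (1 + τ * (S.A20 T₂ / S.A0 T))) * expNeg (τ * v / S.A0 T) := by
  have hAt := hS.A0_ne_top T
  have hA20 : S.A20 T₂ ≠ ∞ := by
    have := pathLoss_ne_top (S := S) T₂ hS.xp_pos
    unfold pathLoss at this
    rw [A20, mul_assoc]
    exact ENNReal.mul_ne_top (by simp [ENNReal.mul_eq_top]) this
  have hset : MeasurableSet {o | (τ : ℝ≥0∞) < S.ownSinr b o v} :=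
    hS.measurableSet_lt_ownSinr b τ v
  have hm : Measurable fun q : ℝ × ℝ × ℝ =>
      {o | (τ : ℝ≥0∞) < S.ownSinr b o v}.indicator (1 : Bool × Bool × Bool × ℝ × ℝ × ℝ → ℝ≥0∞) (T, T₁, T₂, q) :=
    (measurable_one.indicator hset).comp (by fun_prop)
  rw [lintegral_prod_symm' _ hm]
  have h1 : ∀ q : ℝ × ℝ, ∫⁻ F, {o | (τ : ℝ≥0∞) < S.ownSinr b o v}.indicator (1 : Bool × Bool × Bool × ℝ × ℝ × ℝ → ℝ≥0∞)
      (T, T₁, T₂, F, q) ∂expMeasure 1 =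
      (expNeg (τ * S.sig2 / S.A0 T) * expNeg (τ * v / S.A0 T)) *
        (S.active b S.Xs Real.pi q.1 T₁ *
          expNeg (τ * (S.A20 T₂ / S.A0 T) * ENNReal.ofReal q.2)) := by
    rintro ⟨G, G'⟩
    simp only [S.indicator_lt_ownSinr b hτ]
    rw [lintegral_const_mul _ (measurable_one.indicator
      (measurableSet_lt measurable_const (by fun_prop))),
      lintegral_indicator_one (measurableSet_lt measurable_const (by fun_prop)),
      expMeasure_lt_mul (by simp [hτ.ne', hS.sig2_pos.ne']) hAt, mul_add, mul_add, ENNReal.add_div,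
      ENNReal.add_div, expNeg_add, expNeg_add]
    have : τ * (S.A20 T₂ * ENNReal.ofReal G') / S.A0 T =
        τ * (S.A20 T₂ / S.A0 T) * ENNReal.ofReal G' := by
      simp only [div_eq_mul_inv]; ring
    rw [this]
    ring
  simp_rw [h1]
  have hma : Measurable fun G => S.active b S.Xs Real.pi G T₁ :=
    hS.measurable_active b measurable_const measurable_const measurable_id measurable_const
  rw [lintegral_const_mul _ (by fun_prop)]
  -- Without serving power, A₂₀/A₀ may be infinite and the Laplace transform is unavailable, but
  -- positive noise makes the factor e^{-τσ²/A₀} vanish on both sides.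
  by_cases hA : S.A0 T = 0
  · have : (τ : ℝ≥0∞) * S.sig2 / S.A0 T = ∞ := by
      rw [hA, ENNReal.div_zero (by simp [hτ.ne', hS.sig2_pos.ne'])]
    simp [this]
  rw [lintegral_prod_mul
    (g := fun G' => expNeg (τ * (S.A20 T₂ / S.A0 T) * ENNReal.ofReal G')) hma.aemeasurable
    (by fun_prop), hS.lintegral_active b hS.Xs_ne_Yp, lintegral_expNeg_expMeasure
    (ENNReal.mul_ne_top (by simp) (ENNReal.div_ne_top hA20 hA))]
  have h10 : 1 / S.A10 b T₁ = S.rho / (S.ps * S.gpr (S.omegap - b.angle S.Yp S.Xs) *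
      S.gst (b.angle S.Yp S.Xs - Real.pi) * S.pathLoss T₁ ‖S.Xs - S.Yp‖) := by
    rw [A10, one_div, ENNReal.inv_div (by simp) (by simp [hS.rho_pos.ne']), pathLoss]
    congr 1
    simp only [beta00, z00]
    ring
  rw [h10]
  ring

/-- The coverage probability given the secondary interference `v`. -/
lemma Admissible.own_law_lt (hS : S.Admissible) (b : Bearing) {τ : ℝ≥0} (hτ : 0 < τ)
    (v : ℝ≥0∞) :
    ((S.stateLaw S.rs).prod ((S.stateLaw ‖S.Xs - S.Yp‖).prod ((S.stateLaw S.xp).prod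
      ((expMeasure 1).prod ((expMeasure 1).prod (expMeasure 1))))))
        {o | (τ : ℝ≥0∞) < S.ownSinr b o v} =
      ∑ T : Bool, S.pr T S.rs * expNeg (τ * S.sig2 / S.A0 T) *
        (1 - ∑ T₁ : Bool, S.pr T₁ S.z00 * expNeg (1 / S.A10 b T₁)) *
        (∑ T₂ : Bool, S.pr T₂ S.xp / (1 + τ * (S.A20 T₂ / S.A0 T))) * expNeg (τ * v / S.A0 T) := by
  have hset : MeasurableSet {o | (τ : ℝ≥0∞) < S.ownSinr b o v} :=
    hS.measurableSet_lt_ownSinr b τ v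
  have hm0 : Measurable ({o | (τ : ℝ≥0∞) < S.ownSinr b o v}.indicator (1 : Bool × Bool × Bool × ℝ × ℝ × ℝ → ℝ≥0∞)) :=
    measurable_one.indicator hset
  rw [← lintegral_indicator_one hset, lintegral_prod _ hm0.aemeasurable, lintegral_stateLaw]
  refine Finset.sum_congr rfl fun T _ => ?_
  have hm1 := hm0.comp (measurable_prodMk_left (x := T))
  simp only [Function.comp_def] at hm1
  rw [lintegral_prod _ hm1.aemeasurable, lintegral_stateLaw]
  have h1 : ∀ T₁, ∫⁻ q, {o | (τ : ℝ≥0∞) < S.ownSinr b o v}.indicator (1 : Bool × Bool × Bool × ℝ × ℝ × ℝ → ℝ≥0∞) (T, T₁, q)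
      ∂(S.stateLaw S.xp).prod ((expMeasure 1).prod ((expMeasure 1).prod (expMeasure 1))) =
      ∑ T₂, S.pr T₂ S.xp * (expNeg (τ * S.sig2 / S.A0 T) * (1 - expNeg (1 / S.A10 b T₁)) *
        (1 / (1 + τ * (S.A20 T₂ / S.A0 T))) * expNeg (τ * v / S.A0 T)) := by
    intro T₁
    have hm2 := hm1.comp (measurable_prodMk_left (x := T₁))
    simp only [Function.comp_def] at hm2
    rw [lintegral_prod _ hm2.aemeasurable, lintegral_stateLaw]
    exact Finset.sum_congr rfl fun T₂ _ => by rw [hS.lintegral_own_fading b hτ]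
  simp_rw [h1]
  have hz : 0 ≤ S.z00 := norm_nonneg _
  rw [S.one_sub_sum_pr hz fun T₄ => expNeg_le_one _]
  simp only [Fintype.sum_bool, div_eq_mul_inv, one_mul, z00]
  ring

end Params

/-! ### The coverage probability -/

lemma Network.sinr_eq_ownSinr {Ω : Type*} (N : Network Ω) (S : Params) (b : Bearing) (ω : Ω) :
    N.sinr S b ω =
      S.ownSinr b (N.own ω) (∑' i, S.interference b (N.X i ω) (N.mark i ω)) := by
  unfold sinr Params.ownSinr primaryInterference secondaryInterference Params.interference
  rfl

/-- The Laplace transform of the shot noise at τ/A₀: Slivnyak's theorem supplies the functional that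
the marking theorem requires. -/
lemma Network.HasModelLaw.laplace_interference {S : Params} (hS : S.Admissible) (b : Bearing)
    (τ : ℝ≥0) {Ω₀ : Type*} [MeasurableSpace Ω₀] (P₀ : Measure Ω₀) [IsProbabilityMeasure P₀]
    (Z : ℕ → Ω₀ → ℂ) (hZ : IsPoissonProcess S.lam Z P₀)
    {Ω : Type*} [MeasurableSpace Ω] (P : Measure Ω) [IsProbabilityMeasure P]
    (N : Network Ω) (hN : N.HasModelLaw S P)
    (hPalm : IsReducedPalm S.lam S.Xs Z P₀ (P.map fun ω => config fun i => N.X i ω))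
    {T : Bool} (hA : S.A0 T ≠ 0) :
    ∫⁻ ω, expNeg (τ * (∑' i, S.interference b (N.X i ω) (N.mark i ω)) / S.A0 T) ∂P =
      expNeg (S.lam *
          ∫⁻ θ in Set.Ioc 0 (2 * Real.pi), ∫⁻ x in Set.Ioi (0 : ℝ),
            (∑ T₃ : Bool, S.pr T₃ x *
              ∫⁻ w, (1 - ∑ T₄ : Bool, S.pr T₄ (S.z0 x θ) *
                  expNeg (S.As0 b T₄ w x θ * ENNReal.ofReal (S.z0 x θ) ^ S.alpha T₄)) /
                (1 + S.Cs τ T T₃ w θ * ENNReal.ofReal x ^ S.alpha T₃) ∂uniformAngle) *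
            ENNReal.ofReal x) := by
  have hmark : IsIndepMarking N.X N.mark S.markKernel P := by
    rw [show (S.markKernel : ℂ → Measure _) = S.markLaw from funext S.markKernel_apply]
    exact hN.marking
  have hg : Measurable (Function.uncurry fun x m => τ * S.interference b x m / S.A0 T) :=
    ((hS.measurable_interference b).const_mul _).div_const _
  have h1 : ∀ ω, τ * (∑' i, S.interference b (N.X i ω) (N.mark i ω)) / S.A0 T =
      ∑' i, τ * S.interference b (N.X i ω) (N.mark i ω) / S.A0 T := by
    intro ω
    simp only [div_eq_mul_inv]
    rw [ENNReal.tsum_mul_right, ENNReal.tsum_mul_left]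
  simp_rw [h1]
  rw [hmark.laplace hN.measurable_X hN.measurable_mark
    (fun f hf => hPalm.laplace hS.lam_pos hZ hN.measurable_X hf) hg]
  have hD : Measurable fun x => ∫⁻ m, (1 - expNeg (τ * S.interference b x m / S.A0 T))
      ∂S.markKernel x :=
    Measurable.lintegral_kernel_prod_right (κ := S.markKernel)
      (f := fun x m => 1 - expNeg (τ * S.interference b x m / S.A0 T))
      (measurable_const.sub (measurable_expNeg.comp hg))
  rw [lintegral_polar hD]
  congr 2
  refine lintegral_congr fun θ => setLIntegral_polar_congr S.Yp θ fun r hr hp => ?_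
  rw [S.markKernel_apply, hS.lintegral_interference b τ hA hr hp]

end SLS

end

theorem mainTheorem2 (S : SLS.Params) (hS : S.Admissible) (b : SLS.Bearing)
    (τ : ℝ≥0) (hτ : 0 < τ)
    -- the secondary transmitters form a Poisson process of density `S.lam`
    {Ω₀ : Type*} [MeasurableSpace Ω₀] (P₀ : Measure Ω₀) [IsProbabilityMeasure P₀]
    (Z : ℕ → Ω₀ → ℂ) (hZ : SLS.IsPoissonProcess S.lam Z P₀)
    -- the network, given that there is a secondary transmitter at `S.Xs`
    {Ω : Type*} [MeasurableSpace Ω] (P : Measure Ω) [IsProbabilityMeasure P]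
    (N : SLS.Network Ω) (hN : N.HasModelLaw S P)
    (hPalm : SLS.IsReducedPalm S.lam S.Xs Z P₀
      (P.map fun ω => SLS.config fun i => N.X i ω)) :
    P {ω | (τ : ℝ≥0∞) < N.sinr S b ω} =
      ∑ T : Bool, S.pr T S.rs * SLS.expNeg (τ * S.sig2 / S.A0 T) *
        (1 - ∑ T₁ : Bool, S.pr T₁ S.z00 * SLS.expNeg (1 / S.A10 b T₁)) *
        (∑ T₂ : Bool, S.pr T₂ S.xp / (1 + τ * (S.A20 T₂ / S.A0 T))) *
        SLS.expNeg (S.lam *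
          ∫⁻ θ in Set.Ioc 0 (2 * Real.pi), ∫⁻ x in Set.Ioi (0 : ℝ),
            (∑ T₃ : Bool, S.pr T₃ x *
              ∫⁻ w, (1 - ∑ T₄ : Bool, S.pr T₄ (S.z0 x θ) *
                  SLS.expNeg (S.As0 b T₄ w x θ * ENNReal.ofReal (S.z0 x θ) ^ S.alpha T₄)) /
                (1 + S.Cs τ T T₃ w θ * ENNReal.ofReal x ^ S.alpha T₃) ∂SLS.uniformAngle) *
            ENNReal.ofReal x) := by
  have hW : Measurable fun p : ℕ → ℂ × (ℝ × Bool × Bool × ℝ × ℝ) =>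
      ∑' i, S.interference b (p i).1 (p i).2 := Measurable.tsum fun i =>
    (hS.measurable_interference b).comp (measurable_pi_apply i)
  have hXM : Measurable fun ω i => (N.X i ω, N.mark i ω) :=
    measurable_pi_lambda _ fun i => (hN.measurable_X i).prodMk (hN.measurable_mark i)
  obtain ⟨V, hVdef⟩ : ∃ V : Ω → ℝ≥0∞,
      V = fun ω => ∑' i, S.interference b (N.X i ω) (N.mark i ω) := ⟨_, rfl⟩
  have hV : Measurable V := by
    have h := hW.comp hXM
    simp only [Function.comp_def] at h
    rwa [hVdef]
  have hind : IndepFun N.own V P := by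
    have h := hN.indep_own.comp measurable_id hW
    simp only [Function.comp_def, id_eq] at h
    rwa [hVdef]
  have hE : MeasurableSet {p : (Bool × Bool × Bool × ℝ × ℝ × ℝ) × ℝ≥0∞ |
      (τ : ℝ≥0∞) < S.ownSinr b p.1 p.2} :=
    measurableSet_lt measurable_const (hS.measurable_ownSinr b)
  have hev : {ω | (τ : ℝ≥0∞) < N.sinr S b ω} = (fun ω => (N.own ω, V ω)) ⁻¹'
      {p : (Bool × Bool × Bool × ℝ × ℝ × ℝ) × ℝ≥0∞ | (τ : ℝ≥0∞) < S.ownSinr b p.1 p.2} := by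
    ext ω
    rw [Set.mem_ofPred_eq, N.sinr_eq_ownSinr, hVdef]
    exact Iff.rfl
  have hown := hN.measurable_own
  have hVp : IsProbabilityMeasure (P.map V) := Measure.isProbabilityMeasure_map hV.aemeasurable
  have hop : IsProbabilityMeasure (P.map N.own) :=
    Measure.isProbabilityMeasure_map hown.aemeasurable
  -- Independence makes the joint law of own variables and interference a product, so the link is
  -- integrated first with the interference frozen at v.
  rw [hev, ← Measure.map_apply (hown.prodMk hV) hE,
    (indepFun_iff_map_prod_eq_prod_map_map hown.aemeasurable hV.aemeasurable).1 hind,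
    Measure.prod_apply_symm hE, hN.law_own]
  simp only [Set.preimage_ofPred_eq, hS.own_law_lt b hτ]
  have hm : ∀ T, Measurable fun v : ℝ≥0∞ => SLS.expNeg (τ * v / S.A0 T) := fun T => by fun_prop
  rw [lintegral_finsetSum _ fun T _ => (hm T).const_mul _]
  refine Finset.sum_congr rfl fun T _ => ?_
  rw [lintegral_const_mul _ (hm T), lintegral_map (hm T) hV]
  -- For A₀ = 0 the noise factor is 0, so the interference factors need not be compared.
  by_cases hA : S.A0 T = 0
  · have : (τ : ℝ≥0∞) * S.sig2 / S.A0 T = ∞ := by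
      rw [hA, ENNReal.div_zero (by simp [hτ.ne', hS.sig2_pos.ne'])]
    simp [this]
  · rw [hVdef, hN.laplace_interference hS b τ P₀ Z hZ P N hPalm hA]
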